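/- All matroids are finite. A matroid is simple if every set of at most two of its elements is independent, a minor of $M$ is a matroid obtained from $M$ by deletions and contractions, and "no $N$-minor" means that no minor is isomorphic to $N$. $U_{2,n}$ is the matroid on $n$ elements whose independent sets are the sets of size at most $2$. Let $M_1,\dots,M_8$ be the following rank-$3$ matroids; in each, the bases are the $3$-element sets that are not among the listed lines. - On $\{0,\dots,8\}$: $M_1$ with lines $012, 036, 147, 258$; $M_2$ with the lines of $M_1$ and $345$; $M_3$ with the lines of $M_2$ and $678$. - On $\{0,\dots,5\}$: $M_4\cong M(K_4)$ with lines $012, 035, 145, 234$. - On $\{0,\dots,6\}$: $M_5$ with lines $012, 036, 146, 256$; $M_6\cong P_7$ with lines $012, 036, 146, 256, 345$; $M_7$ with lines $012, 036, 146, 245$; $M_8$ with lines $012, 036, 146$. Let $M_9$ be the rank-$4$ matroid on $\{0,\dots,8\}$ whose bases are the $4$-element sets that contain none of the lines $012, 034, 156, 278$ and are contained in none of the planes $01234, 01256, 01278$. If $M$ and $N$ are matroids with $E(M)\cap E(N)=\{e\}$, their parallel connection $P_e(M,N)$ is the matroid on $E(M)\cup E(N)$ whose flats are the sets $F\subseteq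 E(M)\cup E(N)$ such that $F\cap E(M)$ is a flat of $M$ and $F\cap E(N)$ is a flat of $N$. A matroid is obtained by taking parallel connections of copies of $U_{2,n}$ if it is isomorphic to $U_{2,n}$, or is $P_e(M,N)$ with $M$ so obtained and $N\cong U_{2,n}$; the one-element matroid of rank $1$ is counted as the parallel connection of zero copies. **Theorem.** Let $r,\ell\ge 1$ be integers, and let $M$ be a simple rank-$r$ matroid with no $M_i$-minor for $i=1,\dots,9$ and no $U_{2,\ell+2}$-minor. Then $|M|\le \ell(r-1)+1$. Moreover, equality holds if and only if $M$ can be obtained by taking parallel connections of copies of $U_{2,\ell+1}$. -/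

import Mathlib

namespace Matroid

universe u v

/-- A matroid is simple if every set of at most two elements of the ground set is independent
(taking `e = f` excludes loops). -/
def IsSimple {α : Type u} (M : Matroid α) : Prop :=
  ∀ e ∈ M.E, ∀ f ∈ M.E, M.Indep {e, f}

/-- `M` is isomorphic to `N`: it is the image of `N` under a map that is injective on the
ground set of `N`. -/
def IsCopyOf {α : Type u} {β : Type v} (M : Matroid α) (N : Matroid β) : Prop :=
  ∃ (f : β → α) (hf : Set.InjOn f N.E), M = N.map f hf

/-- `M` has an `N`-minor: some minor of `M` is isomorphic to `N`. -/
def HasMinor {α : Type u} {β : Type v} (M : Matroid α) (N : Matroid β) : Prop :=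
  ∃ M' : Matroid α, M' ≤m M ∧ M'.IsCopyOf N

/-- The uniform matroid `U_{2,n}`: ground set of `n` elements, and the independent sets are the
sets of size at most two. -/
def uniformTwo (n : ℕ) : Matroid (Fin n) :=
  (IndepMatroid.ofFinset (Set.univ : Set (Fin n)) (fun I => I.card ≤ 2)
    (by simp)
    (fun _ _ hJ hIJ => (Finset.card_le_card hIJ).trans hJ)
    (fun I J _ hJ hlt => by
      obtain ⟨e, heJ, heI⟩ := Finset.exists_mem_notMem_of_card_lt_card hlt
      exact ⟨e, heJ, heI, by rw [Finset.card_insert_of_notMem heI]; omega⟩)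
    (fun _ _ => Set.subset_univ _)).matroid

/-- The simple matroid of rank three drawn in the plane with `n` points in which the long lines
are the given three-point sets: a set is independent when it has at most three elements and is
not one of these lines.  Two different lines meet in at most one point. -/
def ofPlaneLines (n : ℕ) (lines : Finset (Finset (Fin n)))
    (hcard : ∀ L ∈ lines, L.card = 3)
    (hmeet : ∀ L ∈ lines, ∀ L' ∈ lines, L ≠ L' → (L ∩ L').card ≤ 1) : Matroid (Fin n) :=
  (IndepMatroid.ofFinset (Set.univ : Set (Fin n)) (fun I => I.card ≤ 3 ∧ I ∉ lines)
    ⟨by simp, fun h => by simpa using hcard _ h⟩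
    (fun I J hJ hIJ => ⟨(Finset.card_le_card hIJ).trans hJ.1, fun hI => hJ.2 (by
      rwa [← Finset.eq_of_subset_of_card_le hIJ (by rw [hcard I hI]; exact hJ.1)])⟩)
    (fun I J hI hJ hlt => by
      by_contra hcon
      have key : ∀ e ∈ J, e ∉ I → insert e I ∈ lines := fun e heJ heI => by
        by_contra hl
        refine hcon ⟨e, heJ, heI, ?_, hl⟩
        rw [Finset.card_insert_of_notMem heI]
        have := hJ.1
        omega
      obtain ⟨e, heJ, heI⟩ := Finset.exists_mem_notMem_of_card_lt_card hlt
      have hIe := key e heJ heI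
      have hI2 : I.card = 2 := by
        have := hcard _ hIe
        rw [Finset.card_insert_of_notMem heI] at this
        omega
      have hsub : J ⊆ insert e I := by
        intro x hxJ
        by_contra hx
        rw [Finset.mem_insert, not_or] at hx
        have hIx := key x hxJ hx.2
        have hne : insert e I ≠ insert x I := fun h => by
          have : x ∈ insert e I := by rw [h]; exact Finset.mem_insert_self x I
          rw [Finset.mem_insert] at this
          tauto
        have h1 := hmeet _ hIe _ hIx hne
        have h2 : I.card ≤ (insert e I ∩ insert x I).card := Finset.card_le_card
          (Finset.subset_inter (Finset.subset_insert _ _) (Finset.subset_insert _ _))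
        omega
      have : J = insert e I := Finset.eq_of_subset_of_card_le hsub (by
        rw [hcard _ hIe]; omega)
      exact hJ.2 (this ▸ hIe))
    (fun _ _ => Set.subset_univ _)).matroid

/-- The simple matroid of rank four drawn in three-space with `n` points, in which the long lines
are the given three-point sets and the planes other than the unions of a line and a point off it
are the given sets: a set is independent when it has at most four elements, contains no
long line, and is not a four-element subset of a listed plane. -/
def ofSpaceLinesPlanes (n : ℕ) (lines planes : Finset (Finset (Fin n)))
    (hcard : ∀ L ∈ lines, L.card = 3)
    (hmeet : ∀ L ∈ lines, ∀ L' ∈ lines, L ≠ L' → (L ∩ L').card ≤ 1)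
    (hspan : ∀ L ∈ lines, ∀ L' ∈ lines, L ≠ L' → (L ∩ L').card = 1 →
      ∃ P ∈ planes, L ∪ L' ⊆ P)
    (hline : ∀ L ∈ lines, ∀ P ∈ planes, 2 ≤ (L ∩ P).card → L ⊆ P)
    (hplane : ∀ P ∈ planes, ∀ P' ∈ planes, P ≠ P' → P ∩ P' ∈ lines) : Matroid (Fin n) :=
  (IndepMatroid.ofFinset (Set.univ : Set (Fin n))
    (fun I => I.card ≤ 4 ∧ (∀ L ∈ lines, ¬ L ⊆ I) ∧ (I.card = 4 → ∀ P ∈ planes, ¬ I ⊆ P))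
    ⟨by simp, fun L hL h => by
      have := hcard L hL
      rw [Finset.subset_empty.1 h] at this
      simp at this, by simp⟩
    (fun I J hJ hIJ => ⟨(Finset.card_le_card hIJ).trans hJ.1,
      fun L hL h => hJ.2.1 L hL (h.trans hIJ), fun h4 => by
        have : I = J := Finset.eq_of_subset_of_card_le hIJ (by rw [h4]; exact hJ.1)
        subst this
        exact hJ.2.2 h4⟩)
    (fun I J hI hJ hlt => by
      have hline2 : ∀ L ∈ lines, ∀ e, L ⊆ insert e I → e ∈ L ∧ L.erase e ⊆ I ∧
          (L.erase e).card = 2 := fun L hL e h => by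
        have he : e ∈ L := by
          by_contra he
          exact hI.2.1 L hL ((Finset.subset_insert_iff_of_notMem he).1 h)
        exact ⟨he, Finset.subset_insert_iff.1 h, by rw [Finset.card_erase_of_mem he, hcard L hL]⟩
      obtain ⟨e, heJ, heI⟩ := Finset.exists_mem_notMem_of_card_lt_card hlt
      have hJ4 := hJ.1
      by_cases hP : ∃ P ∈ planes, I ⊆ P ∧ I.card = 3
      · obtain ⟨P, hP, hIP, hI3⟩ := hP
        obtain ⟨x, hxJ, hxP⟩ := Finset.not_subset.1 (hJ.2.2 (by omega) P hP)
        have hxI : x ∉ I := fun h => hxP (hIP h)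
        refine ⟨x, hxJ, hxI, by rw [Finset.card_insert_of_notMem hxI]; omega, ?_, ?_⟩
        · intro L hL h
          obtain ⟨h1, h2, h3⟩ := hline2 L hL x h
          refine hxP (hline L hL P hP ?_ h1)
          rw [← h3]
          exact Finset.card_le_card
            (Finset.subset_inter (Finset.erase_subset _ _) (h2.trans hIP))
        · intro _ P' hP' h
          have hne : P ≠ P' := fun h' => hxP (h' ▸ h (Finset.mem_insert_self x I))
          have hl := hplane P hP P' hP' hne
          have hsub : I ⊆ P ∩ P' := Finset.subset_inter hIP ((Finset.subset_insert x I).trans h)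
          have : I = P ∩ P' := Finset.eq_of_subset_of_card_le hsub (by rw [hcard _ hl, hI3])
          exact hI.2.1 _ hl this.ge
      · by_contra! hcon
        have key : ∀ x ∈ J, x ∉ I → ∃ L ∈ lines, L ⊆ insert x I := fun x hxJ hxI => by
          by_contra! hno
          have hc := Finset.card_insert_of_notMem hxI
          obtain ⟨h4, P, hPm, hPs⟩ := hcon x hxJ hxI (by omega) hno
          exact hP ⟨P, hPm, (Finset.subset_insert x I).trans hPs, by omega⟩
        obtain ⟨L, hL, hLs⟩ := key e heJ heI
        obtain ⟨h1, h2, h3⟩ := hline2 L hL e hLs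
        have hI2 := Finset.card_le_card h2
        have hJsub : ¬ J ⊆ insert e I := fun h => by
          have : J = insert e I := Finset.eq_of_subset_of_card_le h (by
            rw [Finset.card_insert_of_notMem heI]; omega)
          exact hJ.2.1 L hL (this ▸ hLs)
        obtain ⟨x, hxJ, hxI⟩ := Finset.not_subset.1 hJsub
        rw [Finset.mem_insert, not_or] at hxI
        obtain ⟨L', hL', hLs'⟩ := key x hxJ hxI.2
        obtain ⟨h1', h2', h3'⟩ := hline2 L' hL' x hLs'
        have hne : L ≠ L' := fun h => by
          have := hLs (h ▸ h1' : x ∈ L)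
          rw [Finset.mem_insert] at this
          tauto
        have hm := hmeet L hL L' hL' hne
        have hu : (L.erase e ∪ L'.erase x).card + (L.erase e ∩ L'.erase x).card = 4 := by
          rw [Finset.card_union_add_card_inter, h3, h3']
        have hi : (L.erase e ∩ L'.erase x).card ≤ (L ∩ L').card := Finset.card_le_card
          (Finset.inter_subset_inter (Finset.erase_subset _ _) (Finset.erase_subset _ _))
        have hus := Finset.union_subset h2 h2'
        have huc := Finset.card_le_card hus
        obtain ⟨P, hPm, hPs⟩ := hspan L hL L' hL' hne (by omega)
        have hIeq : L.erase e ∪ L'.erase x = I := Finset.eq_of_subset_of_card_le hus (by omega)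
        refine hP ⟨P, hPm, ?_, by omega⟩
        rw [← hIeq]
        exact (Finset.union_subset_union (Finset.erase_subset _ _)
          (Finset.erase_subset _ _)).trans hPs)
    (fun _ _ => Set.subset_univ _)).matroid

section Figures

attribute [-instance] Fintype.decidableForallFintype

/-! The matroids of the two figures.  The points of the three `3 × 3` grids are numbered row by
row from the bottom; in the other plane figures `0, 1, 2` are the bottom row from left to right,
followed by the middle points from left to right and the apex. -/

/-- `M₁`: the `3 × 3` grid with the bottom row and the three columns as its long lines. -/
def figM1 : Matroid (Fin 9) :=
  ofPlaneLines 9 {{0, 1, 2}, {0, 3, 6}, {1, 4, 7}, {2, 5, 8}}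
    (by decide +kernel) (by decide +kernel)

/-- `M₂`: also the middle row is a line. -/
def figM2 : Matroid (Fin 9) :=
  ofPlaneLines 9 {{0, 1, 2}, {0, 3, 6}, {1, 4, 7}, {2, 5, 8}, {3, 4, 5}}
    (by decide +kernel) (by decide +kernel)

/-- `M₃`: all three rows and all three columns are lines. -/
def figM3 : Matroid (Fin 9) :=
  ofPlaneLines 9 {{0, 1, 2}, {0, 3, 6}, {1, 4, 7}, {2, 5, 8}, {3, 4, 5}, {6, 7, 8}}
    (by decide +kernel) (by decide +kernel)

/-- `M₄`, the cycle matroid of the complete graph `K₄`. -/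
def figM4 : Matroid (Fin 6) :=
  ofPlaneLines 6 {{0, 1, 2}, {0, 3, 5}, {1, 4, 5}, {2, 3, 4}}
    (by decide +kernel) (by decide +kernel)

/-- `M₅`: three concurrent lines and one transversal. -/
def figM5 : Matroid (Fin 7) :=
  ofPlaneLines 7 {{0, 1, 2}, {0, 3, 6}, {1, 4, 6}, {2, 5, 6}}
    (by decide +kernel) (by decide +kernel)

/-- `M₆`, also called `P₇`: three concurrent lines and two disjoint transversals. -/
def figM6 : Matroid (Fin 7) :=
  ofPlaneLines 7 {{0, 1, 2}, {0, 3, 6}, {1, 4, 6}, {2, 5, 6}, {3, 4, 5}}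
    (by decide +kernel) (by decide +kernel)

/-- `M₇`. -/
def figM7 : Matroid (Fin 7) :=
  ofPlaneLines 7 {{0, 1, 2}, {0, 3, 6}, {1, 4, 6}, {2, 4, 5}}
    (by decide +kernel) (by decide +kernel)

/-- `M₈`: a triangle of three lines and one further point `5` on no long line. -/
def figM8 : Matroid (Fin 7) :=
  ofPlaneLines 7 {{0, 1, 2}, {0, 3, 6}, {1, 4, 6}}
    (by decide +kernel) (by decide +kernel)

/-- The rank-four matroid: a line `{0, 1, 2}` lying on three planes, and in each of the planes
a second line through a different point of the first one. -/
def figRankFour : Matroid (Fin 9) :=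
  ofSpaceLinesPlanes 9 {{0, 1, 2}, {0, 3, 4}, {1, 5, 6}, {2, 7, 8}}
    {{0, 1, 2, 3, 4}, {0, 1, 2, 5, 6}, {0, 1, 2, 7, 8}}
    (by decide +kernel) (by decide +kernel) (by decide +kernel) (by decide +kernel)
    (by decide +kernel)

end Figures

/-- `M` has none of the matroids of the two figures as a minor. -/
def NoFigureMinor {α : Type u} (M : Matroid α) : Prop :=
  ¬ M.HasMinor figM1 ∧ ¬ M.HasMinor figM2 ∧ ¬ M.HasMinor figM3 ∧ ¬ M.HasMinor figM4 ∧
    ¬ M.HasMinor figM5 ∧ ¬ M.HasMinor figM6 ∧ ¬ M.HasMinor figM7 ∧ ¬ M.HasMinor figM8 ∧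
    ¬ M.HasMinor figRankFour

/-- `P` is the parallel connection `P_e(M, N)` of `M` and `N`, whose ground sets meet exactly in
the basepoint `e`: it lives on the union of the ground sets, and its flats are the sets that
meet both ground sets in flats.  (A matroid is determined by its ground set and flats.) -/
structure IsParallelConnection {α : Type u} (P M N : Matroid α) (e : α) : Prop where
  inter_eq : M.E ∩ N.E = {e}
  ground_eq : P.E = M.E ∪ N.E
  isFlat_iff : ∀ F : Set α,
    P.IsFlat F ↔ F ⊆ M.E ∪ N.E ∧ M.IsFlat (F ∩ M.E) ∧ N.IsFlat (F ∩ N.E)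

/-- The matroids obtained by taking parallel connections of copies of `U_{2,l+1}`: start with
one copy and successively take parallel connections with further copies, at arbitrary basepoints.
The parallel connection of zero copies is the one-element matroid of rank one. -/
inductive IsLineParallelConnection {α : Type u} (l : ℕ) : Matroid α → Prop
  | point (M : Matroid α) (e : α) : M.E = {e} → M.Indep {e} → IsLineParallelConnection l M
  | line (M : Matroid α) : M.IsCopyOf (uniformTwo (l + 1)) → IsLineParallelConnection l M
  | connect (P M N : Matroid α) (e : α) : IsLineParallelConnection l M →
      N.IsCopyOf (uniformTwo (l + 1)) → IsParallelConnection P M N e →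
      IsLineParallelConnection l P

end Matroid

/-! Call a line (a rank-two flat) long if it has at least three points. Everything rests on one
structural fact, `exists_onAtMostOneLongLine`: a nonempty simple matroid without the nine excluded
minors has a point `t` on at most one long line. Contracting `t` then identifies points only along a
single line `K`, which has at most `l + 1` points. The simplification of `M ／ {t}` has rank one less
and at most `l` points fewer, so the bound follows by induction on the rank
(`IsBoundedSimple.ncard_le`).

The structural fact comes from a stronger statement, `IsLongLine.ground_subset`: if every point off
a long line `L₀` is on two long lines, there are no points off `L₀`. In a smallest counterexample
take another long line `L`; each of its points is on a further long line. If `M ／ L` has a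
separation, every long line lies on one side of it apart from `L`, and the side not containing `L₀`,
together with `L`, is a smaller counterexample. If `M ／ L` is inseparable, pick points `z i` off `L`
on long lines through three points of `L`. Deleting or contracting each remaining element keeps the
contraction of `L` inseparable, until it lives on the `z i` alone. There it has rank one, so that
all three long lines lie in one plane, or it is a three-point line, so that they lie in three planes
through `L` in rank four.

These two configurations are treated by finite case analysis. A planar one yields one of `M₁, …, M₈`
(`Config.false_of_grid`, built on `Config.false_of_triangle`), the other yields `M₉` or, after
contracting a point, a planar excluded minor (`Config.false_of_space`). The cases split on whether a
given set is independent, and further independent sets are derived mechanically from submodularity.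

For equality, contract a suitable point `e`. By induction the simplified contraction is a parallel
connection of lines, so it has a leaf line, consisting of `l` points `T` and an attaching point.
Within a small restriction around `T` there is a point `t ∈ T` on at most one long line of `M`.
Equality forces the line of `t` to have `l + 1` points, and it can only be `T` with one more point.
Hence `M` is a parallel connection of this line and the hyperplane `M.E \ T`
(`IsBoundedSimple.exists_flat_line`). The converse is a count of points and rank
(`IsLineParallelConnection.properties`). -/

namespace Matroid

/-! ### Natural-number rank calculus, including the rank of a contraction. -/

section RankFunction

variable {α : Type*} {M N : Matroid α} {X Y : Set α} {e f : α}

/-- The rank of a set, as a natural number. -/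
noncomputable def rk (M : Matroid α) (X : Set α) : ℕ := (M.eRk X).toNat

/-- `toNat` sends infinite rank to `0`, so `rk` is meaningful only with finite rank, which is
assumed wherever ranks are compared. -/
lemma coe_rk (M : Matroid α) [M.RankFinite] (X : Set α) : (M.rk X : ℕ∞) = M.eRk X :=
  ENat.natCast_toNat (eRk_ne_top_iff.2 (RankFinite.isRkFinite X))

@[simp] lemma rk_empty (M : Matroid α) : M.rk ∅ = 0 := by simp [rk]

lemma rk_mono (M : Matroid α) [M.RankFinite] (h : X ⊆ Y) : M.rk X ≤ M.rk Y := by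
  have := M.eRk_mono h
  rw [← coe_rk, ← coe_rk] at this
  exact_mod_cast this

lemma rk_submod (M : Matroid α) [M.RankFinite] (X Y : Set α) :
    M.rk (X ∩ Y) + M.rk (X ∪ Y) ≤ M.rk X + M.rk Y := by
  have := M.eRk_inter_add_eRk_union_le X Y
  simp only [← coe_rk] at this
  exact_mod_cast this

lemma rk_union_le (M : Matroid α) [M.RankFinite] (X Y : Set α) :
    M.rk (X ∪ Y) ≤ M.rk X + M.rk Y := by
  have := M.rk_submod X Y
  omega

lemma rk_insert_le (M : Matroid α) [M.RankFinite] (e : α) (X : Set α) :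
    M.rk (insert e X) ≤ M.rk X + 1 := by
  have := M.eRk_insert_le_add_one e X
  simp only [← coe_rk] at this
  exact_mod_cast this

lemma rk_singleton_le (M : Matroid α) [M.RankFinite] (e : α) : M.rk {e} ≤ 1 := by
  simpa using M.rk_insert_le e ∅

lemma rk_le_ncard (M : Matroid α) [M.RankFinite] (hX : X.Finite) : M.rk X ≤ X.ncard := by
  have := M.eRk_le_encard X
  rw [← coe_rk, ← hX.cast_ncard_eq] at this
  exact_mod_cast this

lemma indep_iff_rk [M.RankFinite] (hX : X.Finite) : M.Indep X ↔ M.rk X = X.ncard := by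
  rw [indep_iff_eRk_eq_encard_of_finite hX, ← coe_rk, ← hX.cast_ncard_eq]
  exact_mod_cast Iff.rfl

lemma rk_closure (M : Matroid α) (X : Set α) : M.rk (M.closure X) = M.rk X := by simp [rk]

lemma eRank_eq_rk (M : Matroid α) [M.RankFinite] : M.eRank = M.rk M.E := by
  rw [coe_rk, eRk_ground]

lemma rk_inter_ground (M : Matroid α) (X : Set α) : M.rk (X ∩ M.E) = M.rk X := by simp [rk]

lemma rk_restrict (M : Matroid α) (h : X ⊆ Y) : (M ↾ Y).rk X = M.rk X := by
  rw [rk, rk, restrict_eRk_eq _ h]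

lemma mem_closure_iff_rk [M.RankFinite] (he : e ∈ M.E) :
    e ∈ M.closure X ↔ M.rk (insert e X) = M.rk X := by
  constructor
  · intro h
    rw [← rk_closure, closure_insert_eq_of_mem_closure h, rk_closure]
  · intro h
    by_contra hcon
    have := M.eRk_insert_eq_add_one ⟨he, hcon⟩
    simp only [← coe_rk] at this
    have : M.rk (insert e X) = M.rk X + 1 := by exact_mod_cast this
    omega

lemma rk_insert_of_notMem_closure [M.RankFinite] (he : e ∈ M.E) (h : e ∉ M.closure X) :
    M.rk (insert e X) = M.rk X + 1 := by
  have h1 := M.rk_insert_le e X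
  have h2 := M.rk_mono (Set.subset_insert e X)
  rw [mem_closure_iff_rk he] at h
  omega

lemma subset_closure_of_rk_le [M.RankFinite] (hY : Y ⊆ M.E) (hXY : X ⊆ Y)
    (h : M.rk Y ≤ M.rk X) : Y ⊆ M.closure X := by
  intro y hy
  rw [mem_closure_iff_rk (hY hy)]
  exact le_antisymm ((M.rk_mono (Set.insert_subset hy hXY)).trans h)
    (M.rk_mono (Set.subset_insert _ _))

lemma rk_le_of_subset_closure [M.RankFinite] (h : Y ⊆ M.closure X) : M.rk Y ≤ M.rk X := by
  rw [← M.rk_closure X]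
  exact M.rk_mono h

lemma rk_le_rk_union_of_subset_closure [M.RankFinite] {Z : Set α} (h : Y ⊆ M.closure X) :
    M.rk (Y ∪ Z) ≤ M.rk (X ∪ Z) := by
  have := M.eRk_mono (Set.union_subset_union_left Z h)
  rw [eRk_union_closure_left_eq, ← coe_rk, ← coe_rk] at this
  exact_mod_cast this

/-- A basis `J` of `X` in `M ／ C` and a basis `I` of `C` are disjoint, and `J ∪ I` is independent
and spans `X ∪ C`. The sets may contain elements outside the ground set, which do not affect ranks;
this form of the formula avoids subtraction. -/
lemma rk_contract_add (M : Matroid α) [M.RankFinite] (C X : Set α) :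
    (M ／ C).rk X + M.rk C = M.rk (X ∪ C) := by
  obtain ⟨I, hI⟩ := M.exists_isBasis' C
  obtain ⟨J, hJ⟩ := (M ／ C).exists_isBasis' X
  have hJi := hJ.indep
  rw [hI.contract_indep_iff] at hJi
  have hdj : Disjoint J I := hJi.2.symm.mono_right hI.subset
  have hcl : X ∪ C ⊆ M.closure (J ∪ I) ∪ M.Eᶜ := by
    rintro x hx
    by_cases hxE : x ∈ M.E
    · left
      have hIC : M.closure (J ∪ I) = M.closure (J ∪ C) := by
        rw [← closure_union_closure_right_eq, hI.closure_eq_closure, closure_union_closure_right_eq]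
      rw [hIC]
      by_cases hxC : x ∈ C
      · exact M.mem_closure_of_mem' (Or.inr hxC) hxE
      · have hxX : x ∈ X := hx.resolve_right hxC
        have h1 : x ∈ (M ／ C).closure J := by
          rw [hJ.closure_eq_closure]
          exact (M ／ C).mem_closure_of_mem' hxX ⟨hxE, hxC⟩
        rw [contract_closure_eq] at h1
        exact h1.1
    · exact Or.inr hxE
  have h1 : M.rk (X ∪ C) ≤ M.rk (J ∪ I) := by
    rw [← rk_inter_ground]
    refine rk_le_of_subset_closure fun x hx => (hcl hx.1).resolve_right fun h => h hx.2
  have h2 : M.rk (J ∪ I) ≤ M.rk (X ∪ C) := M.rk_mono (Set.union_subset_union hJ.subset hI.subset)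
  have hJf : J.Finite := (hJi.1.subset Set.subset_union_left).finite
  have hIf : I.Finite := hI.indep.finite
  have h3 : M.rk (J ∪ I) = J.ncard + I.ncard := by
    rw [(indep_iff_rk (hJf.union hIf)).1 hJi.1, Set.ncard_union_eq hdj hJf hIf]
  have h4 : (M ／ C).rk X = J.ncard := by
    have := hJ.encard_eq_eRk
    rw [← coe_rk, ← hJf.cast_ncard_eq] at this
    exact_mod_cast this.symm
  have h5 : M.rk C = I.ncard := by
    have := hI.encard_eq_eRk
    rw [← coe_rk, ← hIf.cast_ncard_eq] at this
    exact_mod_cast this.symm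
  omega

lemma isFlat_iff_forall_rk [M.RankFinite] (hX : X ⊆ M.E) :
    M.IsFlat X ↔ ∀ e ∈ M.E, e ∉ X → M.rk (insert e X) = M.rk X + 1 := by
  rw [isFlat_iff_closure_eq]
  constructor
  · intro h e he heX
    exact rk_insert_of_notMem_closure he (by rwa [h])
  · intro h
    refine Set.Subset.antisymm (fun e he => ?_) (M.subset_closure X)
    by_contra heX
    have heE := mem_ground_of_mem_closure he
    have h1 := h e heE heX
    rw [mem_closure_iff_rk heE] at he
    omega

lemma isFlat_restrict (hX : M.IsFlat X) (hXY : X ⊆ Y) (hY : Y ⊆ M.E) : (M ↾ Y).IsFlat X := by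
  rw [isFlat_iff_closure_eq, restrict_closure_eq _ hXY hY, hX.closure, Set.inter_eq_left]
  exact hXY

end RankFunction

/-! ### Simple matroids, and passing the excluded-minor hypotheses to minors. -/

section Simple

variable {α : Type*} {M : Matroid α} {e f : α} {X : Set α}

lemma IsSimple.rk_singleton [M.RankFinite] (h : M.IsSimple) (he : e ∈ M.E) : M.rk {e} = 1 := by
  have := h e he e he
  rw [indep_iff_rk (by simp)] at this
  simpa using this

lemma IsSimple.rk_pair [M.RankFinite] (h : M.IsSimple) (he : e ∈ M.E) (hf : f ∈ M.E)
    (hne : e ≠ f) : M.rk {e, f} = 2 := by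
  have := h e he f hf
  rw [indep_iff_rk (by simp)] at this
  rw [this, Set.ncard_pair hne]

lemma IsSimple.restrict (h : M.IsSimple) (hX : X ⊆ M.E) : (M ↾ X).IsSimple := by
  intro e he f hf
  refine restrict_indep_iff.2 ⟨h e (hX he) f (hX hf), ?_⟩
  rintro x (rfl | rfl)
  exacts [he, hf]

lemma HasMinor.trans_isMinor {β : Type*} {F : Matroid β} {N : Matroid α} (h : N.HasMinor F)
    (hN : N ≤m M) : M.HasMinor F := by
  obtain ⟨N', h1, h2⟩ := h
  exact ⟨N', h1.trans hN, h2⟩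

lemma NoFigureMinor.isMinor {N : Matroid α} (h : M.NoFigureMinor) (hN : N ≤m M) :
    N.NoFigureMinor := by
  obtain ⟨h1, h2, h3, h4, h5, h6, h7, h8, h9⟩ := h
  exact ⟨fun h => h1 (h.trans_isMinor hN), fun h => h2 (h.trans_isMinor hN),
    fun h => h3 (h.trans_isMinor hN), fun h => h4 (h.trans_isMinor hN),
    fun h => h5 (h.trans_isMinor hN), fun h => h6 (h.trans_isMinor hN),
    fun h => h7 (h.trans_isMinor hN), fun h => h8 (h.trans_isMinor hN),
    fun h => h9 (h.trans_isMinor hN)⟩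

lemma restrict_isMinor (M : Matroid α) (hX : X ⊆ M.E) : M ↾ X ≤m M :=
  ⟨∅, M.E \ X, by rw [contract_empty, delete_eq_restrict, Set.sdiff_sdiff_cancel_left hX]⟩

lemma contract_isMinor' (M : Matroid α) (C : Set α) : M ／ C ≤m M :=
  ⟨C, ∅, by simp⟩

lemma IsMinor.finite' {N : Matroid α} (h : N ≤m M) (hM : M.Finite) : N.Finite :=
  ⟨hM.ground_finite.subset h.subset⟩

end Simple

/-! ### Point configurations and mechanical derivation of independent sets by submodularity. -/

section Configuration

/-- The subset of `Fin n` coded by the binary digits of `m`. -/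
def bits (n m : ℕ) : Finset (Fin n) := Finset.univ.filter fun i => m.testBit i

/-- The number of elements of `bits n m`. -/
def bitCount (n : ℕ) : ℕ → ℕ :=
  Nat.rec (fun _ => 0) (fun _ ih m => Nat.add (Nat.mod m 2) (ih (Nat.div m 2))) n

/-- `List.any`, in a form that is evaluated fast by the kernel. -/
def anyOf {β : Type*} (l : List β) (p : β → Bool) : Bool :=
  List.rec false (fun a _ ih => Bool.rec ih true (p a)) l

lemma anyOf_eq_true {β : Type*} {l : List β} {p : β → Bool} :
    anyOf l p = true ↔ ∃ a ∈ l, p a = true := by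
  induction l with
  | nil => simp [anyOf]
  | cons a l ih =>
    have : anyOf (a :: l) p = Bool.rec (anyOf l p) true (p a) := rfl
    rw [this]
    cases h : p a <;> simp [h, ih]

/-- The number coding a subset of `Fin n`. -/
def mask {n : ℕ} (T : Finset (Fin n)) : ℕ :=
  (List.finRange n).foldr (fun i acc => if i ∈ T then 2 ^ (i : ℕ) ||| acc else acc) 0

lemma card_bits (n m : ℕ) : (bits n m).card = bitCount n m := by
  rw [bits, Finset.card_filter]
  induction n generalizing m with
  | zero => simp [bitCount]
  | succ n ih =>
    rw [Fin.sum_univ_succ, show bitCount (n + 1) m = m % 2 + bitCount n (m / 2) from rfl, ← ih]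
    simp only [Fin.val_zero, Fin.val_succ, Nat.testBit_zero, Nat.testBit_succ, decide_eq_true_eq]
    congr 1
    split_ifs <;> omega

lemma bits_or (n a b : ℕ) : bits n (a ||| b) = bits n a ∪ bits n b := by
  ext i; simp [bits, Finset.mem_filter]

lemma bits_and (n a b : ℕ) : bits n (a &&& b) = bits n a ∩ bits n b := by
  ext i; simp [bits, Finset.mem_filter]

lemma bits_mask {n : ℕ} (T : Finset (Fin n)) : bits n (mask T) = T := by
  have key : ∀ (l : List (Fin n)) (i : Fin n), (l.foldr
      (fun i acc => if i ∈ T then 2 ^ (i : ℕ) ||| acc else acc) 0).testBit i =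
      decide (i ∈ l ∧ i ∈ T) := by
    intro l i
    induction l with
    | nil => simp
    | cons a l ih =>
      rw [List.foldr_cons]
      split_ifs with h
      · rw [Nat.testBit_or, ih, Nat.testBit_two_pow]
        by_cases hai : i = a
        · subst hai; simp [h]
        · have : (a : ℕ) ≠ i := fun h' => hai (Fin.ext h'.symm)
          simp [this, hai]
      · rw [ih]
        by_cases hai : i = a
        · subst hai; simp [h]
        · simp [hai]
  ext i
  simp [bits, mask, key, List.mem_finRange]

/-- Given upper bounds `U` on the ranks of sets and a list `G` of independent sets, a set `T` is
recognised as independent if it spans, together with a set `l` all of whose rank it sees,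
an independent set of the same size. -/
def derivable (n : ℕ) (U : List (ℕ × ℕ)) (G : List ℕ) (T : ℕ) : Bool :=
  anyOf U fun l => Nat.ble l.2 (bitCount n (Nat.land T l.1)) &&
    (anyOf G fun p => Nat.ble l.2 (bitCount n (Nat.land p (Nat.land T l.1)))) &&
    anyOf G fun s => Nat.beq (Nat.lor s (Nat.lor T l.1)) (Nat.lor T l.1) &&
      Nat.beq (bitCount n T) (bitCount n s)

/-- Close the list `G` under `k` rounds of `derivable`, applied to the sets in `cands`. -/
def saturate (n : ℕ) (U : List (ℕ × ℕ)) (cands : List ℕ) : ℕ → List ℕ → List ℕ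
  | 0, G => G
  | k + 1, G => saturate n U cands k
      (G ++ cands.filter fun T => !(anyOf G (Nat.beq T)) && derivable n U G T)

variable {α : Type*} {N : Matroid α} {n m : ℕ} {f : Fin n → α}
  {U : List (Finset (Fin n) × ℕ)} {G : List (Finset (Fin n))}

lemma rk_image_submod (N : Matroid α) [N.RankFinite] (f : Fin n → α) (A B : Finset (Fin n)) :
    N.rk (f '' ↑(A ∩ B)) + N.rk (f '' ↑(A ∪ B)) ≤ N.rk (f '' A) + N.rk (f '' B) := by
  have h1 := N.rk_submod (f '' A) (f '' B)
  rw [← Set.image_union, ← Finset.coe_union] at h1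
  have h2 : N.rk (f '' ↑(A ∩ B)) ≤ N.rk (f '' A ∩ f '' B) := by
    refine N.rk_mono ?_
    rw [Finset.coe_inter]
    exact Set.image_inter_subset _ _ _
  omega

lemma rk_image_mono (N : Matroid α) [N.RankFinite] (f : Fin n → α) {A B : Finset (Fin n)}
    (h : A ⊆ B) : N.rk (f '' A) ≤ N.rk (f '' B) :=
  N.rk_mono (Set.image_mono (Finset.coe_subset.2 h))

lemma rk_image_le_card (N : Matroid α) [N.RankFinite] (f : Fin n → α) (A : Finset (Fin n)) :
    N.rk (f '' A) ≤ A.card := by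
  refine (N.rk_le_ncard (A.finite_toSet.image f)).trans ?_
  simpa [Set.ncard_coe_finset] using Set.ncard_image_le A.finite_toSet (f := f)

lemma rk_image_le_add (N : Matroid α) [N.RankFinite] (f : Fin n → α) (A B : Finset (Fin n)) :
    N.rk (f '' A) ≤ N.rk (f '' B) + (A \ B).card := by
  have h1 := rk_image_submod N f B (A \ B)
  have h2 := rk_image_le_card N f (A \ B)
  have h3 := rk_image_mono N f (show A ⊆ B ∪ A \ B by simp)
  omega

lemma card_le_rk_image_of_subset [N.RankFinite] {A B : Finset (Fin n)}
    (hB : B.card ≤ N.rk (f '' B)) (h : A ⊆ B) : A.card ≤ N.rk (f '' A) := by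
  have h1 := rk_image_le_add N f B A
  have h2 := Finset.card_sdiff_add_card_eq_card h
  omega

/-- Submodularity for `T` and a set `l` of rank at most `l.2`: since `T ∩ l` has rank at least `l.2`
(witnessed by `p`), the rank of `T` is at least that of `T ∪ l`, which contains the independent set
`s` of the same size as `T`. -/
lemma card_le_rk_image_of_derivable [N.RankFinite] {U : List (ℕ × ℕ)} {G : List ℕ} {T : ℕ}
    (hU : ∀ l ∈ U, N.rk (f '' (bits n l.1)) ≤ l.2)
    (hG : ∀ s ∈ G, (bits n s).card ≤ N.rk (f '' (bits n s))) (h : derivable n U G T = true) :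
    (bits n T).card ≤ N.rk (f '' (bits n T)) := by
  simp only [derivable, anyOf_eq_true, Bool.and_eq_true, Nat.ble_eq, Nat.beq_eq] at h
  obtain ⟨l, hl, ⟨-, p, hp, h1⟩, s, hs, h2, h3⟩ := h
  change l.2 ≤ bitCount n (p &&& (T &&& l.1)) at h1
  change s ||| (T ||| l.1) = T ||| l.1 at h2
  have h4 : bits n s ⊆ bits n T ∪ bits n l.1 := by
    rw [← bits_or, ← h2, bits_or]
    exact Finset.subset_union_left
  rw [← card_bits, bits_and, bits_and] at h1
  rw [← card_bits, ← card_bits] at h3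
  have h5 := card_le_rk_image_of_subset (hG p hp)
    (Finset.inter_subset_left (s₁ := bits n p) (s₂ := bits n T ∩ bits n l.1))
  have h6 := rk_image_mono N f
    (Finset.inter_subset_right (s₁ := bits n p) (s₂ := bits n T ∩ bits n l.1))
  have h7 := rk_image_submod N f (bits n T) (bits n l.1)
  have h8 := rk_image_mono N f h4
  have h9 := hU l hl
  have h10 := hG s hs
  omega

lemma card_le_rk_image_of_saturate [N.RankFinite] {U : List (ℕ × ℕ)} {cands : List ℕ}
    (hU : ∀ l ∈ U, N.rk (f '' (bits n l.1)) ≤ l.2) (k : ℕ) {G : List ℕ}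
    (hG : ∀ s ∈ G, (bits n s).card ≤ N.rk (f '' (bits n s))) :
    ∀ s ∈ saturate n U cands k G, (bits n s).card ≤ N.rk (f '' (bits n s)) := by
  induction k generalizing G with
  | zero => exact hG
  | succ k ih =>
    refine ih fun s hs => ?_
    rw [List.mem_append] at hs
    rcases hs with hs | hs
    · exact hG s hs
    · rw [List.mem_filter, Bool.and_eq_true] at hs
      exact card_le_rk_image_of_derivable hU hG hs.2.2

/-- The points `f 0, f 1, …` of `N` satisfy the upper bounds on ranks listed in `U`, and the sets
of points listed in `G` are independent. -/
structure Config (N : Matroid α) (f : Fin n → α) (U : List (Finset (Fin n) × ℕ))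
    (G : List (Finset (Fin n))) : Prop where
  mem : ∀ i, f i ∈ N.E
  upper : ∀ p ∈ U, N.rk (f '' p.1) ≤ p.2
  lower : ∀ T ∈ G, T.card ≤ N.rk (f '' T)

/-- Independent sets that follow from the bounds in `U` and the independent sets in `G`, where
the deduction uses `k` rounds and sets of size `r` only. -/
def consequences (r k : ℕ) (U : List (Finset (Fin n) × ℕ)) (G : List (Finset (Fin n))) : List ℕ :=
  saturate n (U.map fun p => (mask p.1, p.2))
    ((List.range (2 ^ n)).filter fun T => Nat.beq (bitCount n T) r) k (G.map mask)

lemma Config.card_le_of_mem_consequences [N.RankFinite] (h : Config N f U G) {r k s : ℕ}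
    (hs : s ∈ consequences r k U G) : (bits n s).card ≤ N.rk (f '' (bits n s)) := by
  refine card_le_rk_image_of_saturate ?_ k ?_ s hs
  · intro l hl
    obtain ⟨p, hp, rfl⟩ := List.mem_map.1 hl
    simpa only [bits_mask] using h.upper p hp
  · intro s hs
    obtain ⟨T, hT, rfl⟩ := List.mem_map.1 hs
    simpa only [bits_mask] using h.lower T hT

/-- The set coded by `t` is contained in a set coded by a member of `S`. -/
def covered (S : List ℕ) (t : ℕ) : Bool := anyOf S fun s => Nat.beq (Nat.lor t s) s

lemma Config.card_le_of_covered [N.RankFinite] (h : Config N f U G) {r k t : ℕ}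
    (hs : covered (consequences r k U G) t = true) :
    (bits n t).card ≤ N.rk (f '' (bits n t)) := by
  rw [covered, anyOf_eq_true] at hs
  obtain ⟨s, hs, h1⟩ := hs
  refine card_le_rk_image_of_subset (h.card_le_of_mem_consequences hs) ?_
  rw [Nat.beq_eq] at h1
  change t ||| s = s at h1
  rw [← h1, bits_or]
  exact Finset.subset_union_left

/-- The deductions that prove the bounds `U'` and `G'` for the points with the indices `σ i`. -/
def reindexCheck (r k : ℕ) (U : List (Finset (Fin n) × ℕ)) (G : List (Finset (Fin n)))
    (σ : Fin m → Fin n) (U' : List (Finset (Fin m) × ℕ)) (G' : List (Finset (Fin m))) : Bool :=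
  (U'.all fun p => U.any fun l => l.2 + (p.1.image σ \ l.1).card ≤ p.2) &&
    ((fun S => G'.all fun T => covered S (mask (T.image σ)) && (T.image σ).card == T.card)
      (consequences r k U G))

lemma Config.reindex [N.RankFinite] (h : Config N f U G) (r k : ℕ) (σ : Fin m → Fin n)
    {U' : List (Finset (Fin m) × ℕ)} {G' : List (Finset (Fin m))}
    (hc : reindexCheck r k U G σ U' G' = true) : Config N (f ∘ σ) U' G' := by
  simp only [reindexCheck, Bool.and_eq_true, List.all_eq_true, List.any_eq_true,
    decide_eq_true_eq, beq_iff_eq] at hc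
  obtain ⟨h1, h2⟩ := hc
  refine ⟨fun i => h.mem _, fun p hp => ?_, fun T hT => ?_⟩
  · obtain ⟨l, hl, h3⟩ := h1 p hp
    rw [Set.image_comp, ← Finset.coe_image]
    have h4 := rk_image_le_add N f (p.1.image σ) l.1
    have h5 := h.upper l hl
    omega
  · obtain ⟨h3, h4⟩ := h2 T hT
    have h5 := h.card_le_of_covered h3
    rw [bits_mask] at h5
    rwa [Set.image_comp, ← Finset.coe_image, ← h4]

/-- Some set that is independent in consequence of `U` and `G` violates a bound in `U`. -/
def inconsistent (r k : ℕ) (U : List (Finset (Fin n) × ℕ)) (G : List (Finset (Fin n))) : Bool :=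
  (consequences r k U G).any fun s => U.any fun l => l.2 < bitCount n (s &&& mask l.1)

lemma Config.false_of_inconsistent [N.RankFinite] (h : Config N f U G) (r k : ℕ)
    (hc : inconsistent r k U G = true) : False := by
  simp only [inconsistent, List.any_eq_true, decide_eq_true_eq] at hc
  obtain ⟨s, hs, l, hl, h1⟩ := hc
  rw [← card_bits, bits_and, bits_mask] at h1
  have h2 := card_le_rk_image_of_subset (h.card_le_of_mem_consequences hs)
    (Finset.inter_subset_left (s₁ := bits n s) (s₂ := l.1))
  have h3 := rk_image_mono N f (Finset.inter_subset_right (s₁ := bits n s) (s₂ := l.1))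
  have h4 := h.upper l hl
  omega

/-- The branching step of all case analyses: either the set is dependent, a new upper bound, or
independent, a new lower bound. -/
lemma Config.split (h : Config N f U G) (T : Finset (Fin n)) :
    Config N f ((T, T.card - 1) :: U) G ∨ Config N f U (T :: G) := by
  by_cases hT : T.card ≤ N.rk (f '' T)
  · exact Or.inr ⟨h.mem, h.upper, List.forall_mem_cons.2 ⟨hT, h.lower⟩⟩
  · exact Or.inl ⟨h.mem, List.forall_mem_cons.2 ⟨by dsimp only; omega, h.upper⟩, h.lower⟩

/-- Submodularity with `A ∩ B` known to be independent bounds the rank of the union. This produces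
bounds on larger sets, which `reindex` does not. -/
lemma Config.union [N.RankFinite] (h : Config N f U G) (r k : ℕ) {A B : Finset (Fin n)} {a b : ℕ}
    (hA : (A, a) ∈ U) (hB : (B, b) ∈ U)
    (hc : covered (consequences r k U G) (mask (A ∩ B)) = true) :
    Config N f ((A ∪ B, a + b - (A ∩ B).card) :: U) G := by
  refine ⟨h.mem, List.forall_mem_cons.2 ⟨?_, h.upper⟩, h.lower⟩
  have h1 := h.card_le_of_covered hc
  rw [bits_mask] at h1
  have h2 := rk_image_submod N f A B
  have h3 := h.upper _ hA
  have h4 := h.upper _ hB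
  dsimp only at h3 h4 ⊢
  omega

/-- The deductions that prove the bounds `U'` and `G'` for the points with the indices `σ i`
after the point with the index `j` has been contracted. -/
def contractCheck (r k : ℕ) (U : List (Finset (Fin n) × ℕ)) (G : List (Finset (Fin n)))
    (j : Fin n) (σ : Fin m → Fin n) (U' : List (Finset (Fin m) × ℕ))
    (G' : List (Finset (Fin m))) : Bool :=
  (U'.all fun p => U.any fun l => l.2 + (insert j (p.1.image σ) \ l.1).card ≤ p.2 + 1) &&
    ((fun S => ((List.finRange m).all fun i => σ i != j && covered S (mask {σ i, j})) &&
      covered S (mask {j}) &&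
      G'.all fun T => covered S (mask (insert j (T.image σ))) &&
        (insert j (T.image σ)).card == T.card + 1)
      (consequences r k U G))

lemma Config.contract [N.RankFinite] (h : Config N f U G) (r k : ℕ) (j : Fin n)
    (σ : Fin m → Fin n) {U' : List (Finset (Fin m) × ℕ)} {G' : List (Finset (Fin m))}
    (hc : contractCheck r k U G j σ U' G' = true) : Config (N ／ {f j}) (f ∘ σ) U' G' := by
  simp only [contractCheck, Bool.and_eq_true, List.all_eq_true, List.any_eq_true,
    decide_eq_true_eq, beq_iff_eq, List.mem_finRange, true_imp_iff, bne_iff_ne] at hc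
  obtain ⟨h1, ⟨h2, h3⟩, h4⟩ := hc
  have h5 := h.card_le_of_covered h3
  rw [bits_mask, Finset.card_singleton, Finset.coe_singleton, Set.image_singleton] at h5
  have h6 := N.rk_singleton_le (f j)
  have h7 : ∀ T : Finset (Fin m), (N ／ {f j}).rk ((f ∘ σ) '' T) + 1 =
      N.rk (f '' ↑(insert j (T.image σ))) := by
    intro T
    have := N.rk_contract_add {f j} ((f ∘ σ) '' T)
    rw [Set.union_singleton, Set.image_comp, ← Finset.coe_image, ← Set.image_insert_eq,
      ← Finset.coe_insert] at this
    rw [Set.image_comp, ← Finset.coe_image]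
    omega
  -- Independence of the pair `{σ i, j}` keeps `f (σ i)` distinct from the contracted point, hence
  -- in the ground set of the contraction.
  refine ⟨fun i => ⟨h.mem _, fun hij => ?_⟩, fun p hp => ?_, fun T hT => ?_⟩
  · obtain ⟨h8, h9⟩ := h2 i
    have h10 := h.card_le_of_covered h9
    rw [bits_mask, Finset.card_pair h8, Finset.coe_pair, Set.image_pair] at h10
    have h11 : f (σ i) = f j := hij
    rw [h11, Set.pair_eq_singleton] at h10
    omega
  · obtain ⟨l, hl, h8⟩ := h1 p hp
    have h9 := rk_image_le_add N f (insert j (p.1.image σ)) l.1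
    have h10 := h.upper l hl
    have h11 := h7 p.1
    omega
  · obtain ⟨h8, h9⟩ := h4 T hT
    have h10 := h.card_le_of_covered h8
    rw [bits_mask] at h10
    have h11 := h7 T
    omega

/-- The image of the set coded by `t` under `σ`. -/
def imageMask (σ : Fin m → Fin n) (t : ℕ) : ℕ :=
  (List.finRange m).foldr
    (fun (i : Fin m) acc => if t.testBit i then 2 ^ (σ i : ℕ) ||| acc else acc) 0

lemma bits_imageMask (σ : Fin m → Fin n) (t : ℕ) :
    bits n (imageMask σ t) = (bits m t).image σ := by
  have key : ∀ l : List (Fin m), bits n (l.foldr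
      (fun (i : Fin m) acc => if t.testBit i then 2 ^ (σ i : ℕ) ||| acc else acc) 0) =
      (l.toFinset ∩ bits m t).image σ := by
    intro l
    induction l with
    | nil => simp [bits]
    | cons a l ih =>
      have h2 : bits n (2 ^ (σ a : ℕ)) = {σ a} := by
        ext i
        simp [bits, Nat.testBit_two_pow, Fin.ext_iff, eq_comm]
      rw [List.foldr_cons, List.toFinset_cons]
      split_ifs with h
      · rw [bits_or, ih, h2, Finset.insert_inter_of_mem (by simpa [bits] using h),
          Finset.image_insert, Finset.insert_eq]
      · rw [ih, Finset.insert_inter_of_notMem (by simpa [bits] using h)]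
  rw [imageMask, key]
  congr 1
  ext i
  simp

/-- The deductions that identify the points with the indices `σ i` as a copy of the matroid on
`Fin m` in which the set coded by `t` is independent when `p t` holds. -/
def copyCheck (r k : ℕ) (U : List (Finset (Fin n) × ℕ)) (G : List (Finset (Fin n)))
    (σ : Fin m → Fin n) (p : ℕ → Bool) : Bool :=
  (fun (S : List ℕ) (V : List (ℕ × ℕ)) => (List.range (2 ^ m)).all fun t =>
    if p t then covered S (imageMask σ t) && Nat.beq (bitCount n (imageMask σ t)) (bitCount m t)
    else V.any fun l => Nat.blt l.2 (bitCount n (imageMask σ t &&& l.1)))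
  (consequences r k U G) (U.map fun l => (mask l.1, l.2))

lemma mask_lt {n : ℕ} (T : Finset (Fin n)) : mask T < 2 ^ n := by
  rw [mask]
  generalize List.finRange n = l
  induction l with
  | nil => simp
  | cons a l ih =>
    rw [List.foldr_cons]
    split_ifs
    · exact Nat.or_lt_two_pow (Nat.pow_lt_pow_right (by norm_num) a.isLt) ih
    · exact ih

/-- Already the restriction to the chosen points is the copy: the derived independent sets account
for the independent sets of `F`, and the upper bounds force dependence of the others. -/
lemma Config.hasMinor [N.RankFinite] (h : Config N f U G) (F : Matroid (Fin m))
    (hE : F.E = Set.univ) (p : ℕ → Bool)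
    (hp : ∀ T : Finset (Fin m), F.Indep T ↔ p (mask T) = true)
    (hpair : ∀ i j : Fin m, p (mask {i, j}) = true)
    (r k : ℕ) (σ : Fin m → Fin n) (hc : copyCheck r k U G σ p = true) : N.HasMinor F := by
  simp only [copyCheck, List.all_eq_true, List.mem_range] at hc
  have hc' : ∀ T : Finset (Fin m), p (mask T) = true ↔ T.card ≤ N.rk ((f ∘ σ) '' T) := by
    intro T
    have h1 := hc (mask T) (mask_lt T)
    have hI := bits_imageMask σ (mask T)
    rw [bits_mask] at hI
    rw [Set.image_comp, ← Finset.coe_image]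
    split_ifs at h1 with hT
    · rw [Bool.and_eq_true, Nat.beq_eq, ← card_bits, ← card_bits, hI, bits_mask] at h1
      refine iff_of_true hT ?_
      rw [← h1.2]
      rw [← hI]
      exact h.card_le_of_covered h1.1
    · refine iff_of_false hT ?_
      simp only [List.any_eq_true, List.mem_map] at h1
      obtain ⟨_, ⟨l, hl, rfl⟩, h2⟩ := h1
      rw [Nat.blt_eq, ← card_bits, bits_and, hI, bits_mask] at h2
      have h3 := rk_image_le_add N f (T.image σ) (T.image σ ∩ l.1)
      have h4 := h.upper l hl
      have h5 := rk_image_mono N f (Finset.inter_subset_right (s₁ := T.image σ) (s₂ := l.1))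
      have h6 : (T.image σ).card ≤ T.card := Finset.card_image_le
      have h7 := Finset.card_sdiff_add_card_eq_card
        (Finset.inter_subset_left (s₁ := T.image σ) (s₂ := l.1))
      omega
  -- A configuration may repeat points; independence of all pairs in `F` excludes this for the
  -- chosen ones.
  have hinj : Function.Injective (f ∘ σ) := by
    intro i j hij
    by_contra hne
    have h1 := (hc' {i, j}).1 (hpair i j)
    rw [Finset.card_pair hne, Finset.coe_pair, Set.image_pair, hij, Set.pair_eq_singleton] at h1
    have := N.rk_singleton_le ((f ∘ σ) j)
    omega
  have hsub : Set.range (f ∘ σ) ⊆ N.E := by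
    rintro _ ⟨i, rfl⟩
    exact h.mem _
  refine ⟨N ↾ Set.range (f ∘ σ), N.restrict_isMinor hsub, f ∘ σ, hinj.injOn, ?_⟩
  refine ext_indep (by rw [restrict_ground_eq, map_ground, hE, Set.image_univ]) fun I hI => ?_
  rw [restrict_ground_eq] at hI
  obtain ⟨I₀, rfl⟩ : ∃ I₀ : Finset (Fin m), (f ∘ σ) '' ↑I₀ = I := by
    refine ⟨(Set.toFinite ((f ∘ σ) ⁻¹' I)).toFinset, ?_⟩
    rw [Set.Finite.coe_toFinset, Set.image_preimage_eq_of_subset hI]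
  rw [restrict_indep_iff, and_iff_left hI, map_indep_iff]
  have h2 : N.Indep ((f ∘ σ) '' I₀) ↔ F.Indep I₀ := by
    rw [hp, hc', indep_iff_rk (I₀.finite_toSet.image _), Set.ncard_image_of_injective _ hinj,
      Set.ncard_coe_finset]
    have := rk_image_le_card N (f ∘ σ) I₀
    omega
  rw [h2]
  constructor
  · exact fun h => ⟨_, h, rfl⟩
  · rintro ⟨J, hJ, hJI⟩
    rwa [hinj.image_injective hJI]

lemma mask_injective {n : ℕ} : Function.Injective (mask (n := n)) := fun S T h => by
  rw [← bits_mask S, h, bits_mask]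

lemma mask_or_eq_iff {n : ℕ} {S T : Finset (Fin n)} : mask S ||| mask T = mask T ↔ S ⊆ T := by
  constructor
  · intro h
    rw [← bits_mask S, ← bits_mask T, ← h, bits_or]
    exact Finset.subset_union_left
  · intro h
    refine Nat.eq_of_testBit_eq fun i => ?_
    rw [Nat.testBit_or]
    by_cases hi : i < n
    · have key : ∀ T : Finset (Fin n), (mask T).testBit i = decide ((⟨i, hi⟩ : Fin n) ∈ T) := by
        intro T
        conv_rhs => rw [← bits_mask T]
        simp [bits]
      rw [key, key]
      by_cases h1 : (⟨i, hi⟩ : Fin n) ∈ S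
      · simp [h1, h h1]
      · simp [h1]
    · have key : ∀ T : Finset (Fin n), (mask T).testBit i = false := fun T =>
        Nat.testBit_lt_two_pow ((mask_lt T).trans_le (Nat.pow_le_pow_right (by norm_num)
          (not_lt.1 hi)))
      rw [key, key, Bool.or_false]

/-- Independence in `ofPlaneLines`, for coded sets. -/
def planeIndep (n : ℕ) (lines : List ℕ) (t : ℕ) : Bool :=
  Nat.ble (bitCount n t) 3 && !(lines.any (Nat.beq t))

/-- Independence in `ofSpaceLinesPlanes`, for coded sets. -/
def spaceIndep (n : ℕ) (lines planes : List ℕ) (t : ℕ) : Bool :=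
  Nat.ble (bitCount n t) 4 && ((lines.all fun l => !(Nat.beq (l ||| t) t)) &&
    (!(Nat.beq (bitCount n t) 4) || planes.all fun l => !(Nat.beq (t ||| l) l)))

lemma ofPlaneLines_indep {n : ℕ} (L : List (Finset (Fin n))) {lines : Finset (Finset (Fin n))}
    (hL : L.toFinset = lines) (h1 h2) (T : Finset (Fin n)) :
    (ofPlaneLines n lines h1 h2).Indep T ↔ planeIndep n (L.map mask) (mask T) = true := by
  subst hL
  rw [ofPlaneLines, IndepMatroid.matroid_Indep, IndepMatroid.ofFinset_indep, planeIndep,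
    Bool.and_eq_true, Nat.ble_eq, ← card_bits, bits_mask, Bool.not_eq_true', Bool.eq_false_iff]
  simp only [List.mem_toFinset, ne_eq, List.any_eq_true, List.mem_map, Nat.beq_eq,
    exists_exists_and_eq_and, mask_injective.eq_iff, exists_eq_right']

lemma ofSpaceLinesPlanes_indep {n : ℕ} (L P : List (Finset (Fin n)))
    {lines planes : Finset (Finset (Fin n))} (hL : L.toFinset = lines) (hP : P.toFinset = planes)
    (h1 h2 h3 h4 h5) (T : Finset (Fin n)) :
    (ofSpaceLinesPlanes n lines planes h1 h2 h3 h4 h5).Indep T ↔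
    spaceIndep n (L.map mask) (P.map mask) (mask T) = true := by
  subst hL hP
  rw [ofSpaceLinesPlanes, IndepMatroid.matroid_Indep, IndepMatroid.ofFinset_indep, spaceIndep,
    Bool.and_eq_true, Nat.ble_eq, ← card_bits, bits_mask]
  simp only [Bool.and_eq_true, Bool.or_eq_true, Bool.not_eq_true', Bool.eq_false_iff, ne_eq,
    List.all_eq_true, List.mem_map, forall_exists_index, and_imp, forall_apply_eq_imp_iff₂,
    Nat.beq_eq, mask_or_eq_iff, List.mem_toFinset]
  simp only [imp_iff_not_or]

end Configuration

/-! ### Case analysis producing the excluded minors from small configurations. -/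

section FigureConfigurations

variable {α : Type*} {N : Matroid α} {n : ℕ} {f : Fin n → α}
  {U : List (Finset (Fin n) × ℕ)} {G : List (Finset (Fin n))}

lemma Config.false_of_M1 [N.RankFinite] (h : Config N f U G) (hN : N.NoFigureMinor) (r k : ℕ)
    (σ : Fin 9 → Fin n) (hc : copyCheck r k U G σ (planeIndep 9 (List.map mask
      ([{0, 1, 2}, {0, 3, 6}, {1, 4, 7}, {2, 5, 8}] : List (Finset (Fin 9))))) = true) :
    False :=
  hN.1 (h.hasMinor figM1 rfl _ (ofPlaneLines_indep _ (by decide +kernel) _ _)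
    (by decide +kernel) r k σ hc)

lemma Config.false_of_M2 [N.RankFinite] (h : Config N f U G) (hN : N.NoFigureMinor) (r k : ℕ)
    (σ : Fin 9 → Fin n) (hc : copyCheck r k U G σ (planeIndep 9 (List.map mask
      ([{0, 1, 2}, {0, 3, 6}, {1, 4, 7}, {2, 5, 8}, {3, 4, 5}] : List (Finset (Fin 9))))) = true) :
    False :=
  hN.2.1 (h.hasMinor figM2 rfl _ (ofPlaneLines_indep _ (by decide +kernel) _ _)
    (by decide +kernel) r k σ hc)

lemma Config.false_of_M3 [N.RankFinite] (h : Config N f U G) (hN : N.NoFigureMinor) (r k : ℕ)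
    (σ : Fin 9 → Fin n) (hc : copyCheck r k U G σ (planeIndep 9 (List.map mask
      ([{0, 1, 2}, {0, 3, 6}, {1, 4, 7}, {2, 5, 8}, {3, 4, 5}, {6, 7, 8}] :
        List (Finset (Fin 9))))) = true) :
    False :=
  hN.2.2.1 (h.hasMinor figM3 rfl _ (ofPlaneLines_indep _ (by decide +kernel) _ _)
    (by decide +kernel) r k σ hc)

lemma Config.false_of_M4 [N.RankFinite] (h : Config N f U G) (hN : N.NoFigureMinor) (r k : ℕ)
    (σ : Fin 6 → Fin n) (hc : copyCheck r k U G σ (planeIndep 6 (List.map mask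
      ([{0, 1, 2}, {0, 3, 5}, {1, 4, 5}, {2, 3, 4}] : List (Finset (Fin 6))))) = true) :
    False :=
  hN.2.2.2.1 (h.hasMinor figM4 rfl _ (ofPlaneLines_indep _ (by decide +kernel) _ _)
    (by decide +kernel) r k σ hc)

lemma Config.false_of_M5 [N.RankFinite] (h : Config N f U G) (hN : N.NoFigureMinor) (r k : ℕ)
    (σ : Fin 7 → Fin n) (hc : copyCheck r k U G σ (planeIndep 7 (List.map mask
      ([{0, 1, 2}, {0, 3, 6}, {1, 4, 6}, {2, 5, 6}] : List (Finset (Fin 7))))) = true) :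
    False :=
  hN.2.2.2.2.1 (h.hasMinor figM5 rfl _ (ofPlaneLines_indep _ (by decide +kernel) _ _)
    (by decide +kernel) r k σ hc)

lemma Config.false_of_M6 [N.RankFinite] (h : Config N f U G) (hN : N.NoFigureMinor) (r k : ℕ)
    (σ : Fin 7 → Fin n) (hc : copyCheck r k U G σ (planeIndep 7 (List.map mask
      ([{0, 1, 2}, {0, 3, 6}, {1, 4, 6}, {2, 5, 6}, {3, 4, 5}] : List (Finset (Fin 7))))) = true) :
    False :=
  hN.2.2.2.2.2.1 (h.hasMinor figM6 rfl _ (ofPlaneLines_indep _ (by decide +kernel) _ _)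
    (by decide +kernel) r k σ hc)

lemma Config.false_of_M7 [N.RankFinite] (h : Config N f U G) (hN : N.NoFigureMinor) (r k : ℕ)
    (σ : Fin 7 → Fin n) (hc : copyCheck r k U G σ (planeIndep 7 (List.map mask
      ([{0, 1, 2}, {0, 3, 6}, {1, 4, 6}, {2, 4, 5}] : List (Finset (Fin 7))))) = true) :
    False :=
  hN.2.2.2.2.2.2.1 (h.hasMinor figM7 rfl _ (ofPlaneLines_indep _ (by decide +kernel) _ _)
    (by decide +kernel) r k σ hc)

lemma Config.false_of_M8 [N.RankFinite] (h : Config N f U G) (hN : N.NoFigureMinor) (r k : ℕ)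
    (σ : Fin 7 → Fin n) (hc : copyCheck r k U G σ (planeIndep 7 (List.map mask
      ([{0, 1, 2}, {0, 3, 6}, {1, 4, 6}] : List (Finset (Fin 7))))) = true) :
    False :=
  hN.2.2.2.2.2.2.2.1 (h.hasMinor figM8 rfl _ (ofPlaneLines_indep _ (by decide +kernel) _ _)
    (by decide +kernel) r k σ hc)

lemma Config.false_of_rankFour [N.RankFinite] (h : Config N f U G) (hN : N.NoFigureMinor) (r k : ℕ)
    (σ : Fin 9 → Fin n) (hc : copyCheck r k U G σ (spaceIndep 9
      (List.map mask ([{0, 1, 2}, {0, 3, 4}, {1, 5, 6}, {2, 7, 8}] : List (Finset (Fin 9))))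
      (List.map mask ([{0, 1, 2, 3, 4}, {0, 1, 2, 5, 6}, {0, 1, 2, 7, 8}] :
        List (Finset (Fin 9))))) = true) : False :=
  hN.2.2.2.2.2.2.2.2 (h.hasMinor figRankFour rfl _ (ofSpaceLinesPlanes_indep _ _
    (by decide +kernel) (by decide +kernel) _ _ _ _ _) (by decide +kernel) r k σ hc)

/-- Upper bounds on ranks for a triangle of three-point lines with corners `0, 1, 6`, and one
more point in the same plane. -/
def triangleUpper : List (Finset (Fin 7) × ℕ) :=
  [({0, 1, 2}, 2), ({0, 3, 6}, 2), ({1, 4, 6}, 2), (Finset.univ, 3)]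

/-- The three sides of the triangle are not concurrent, and the point `5` lies on none of them. -/
def triangleLower : List (Finset (Fin 7)) :=
  [{0, 1, 6}, {0, 1, 5}, {0, 5, 6}, {1, 5, 6}, {0, 2}, {1, 2}, {0, 3}, {3, 6}, {1, 4}, {4, 6}]

set_option maxHeartbeats 1000000 in
/-- A triangle of three-point lines with an extra point in its plane yields one of `M₄, …, M₈`. -/
theorem Config.false_of_triangle [N.RankFinite] {f : Fin 7 → α}
    (h : Config N f triangleUpper triangleLower) (hN : N.NoFigureMinor) : False := by
  -- If `234` is collinear, or two of `045`, `135`, `256` are, there is a copy of `M₄`. If exactly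
  -- one of the latter three is, the result is `M₆` or `M₅` according as the triple `235`, `245` or
  -- `345`, respectively, is collinear or not. If none is, at most one of `235`, `245`, `345` can be
  -- collinear, and the result is `M₇` or `M₈`.
  rcases h.split {2, 3, 4} with h | h
  · exact h.false_of_M4 hN 3 3 ![0, 1, 2, 3, 4, 6] (by decide +kernel)
  · rcases h.split {0, 4, 5} with h | h
    · rcases h.split {1, 3, 5} with h | h
      · exact h.false_of_M4 hN 3 3 ![0, 3, 6, 4, 1, 5] (by decide +kernel)
      · rcases h.split {2, 5, 6} with h | h
        · exact h.false_of_M4 hN 3 3 ![0, 1, 2, 5, 6, 4] (by decide +kernel)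
        · rcases h.split {2, 3, 5} with h | h
          · rcases h.split {2, 4, 5} with h | h
            · exact h.false_of_inconsistent 3 3 (by decide +kernel)
            · rcases h.split {3, 4, 5} with h | h
              · exact h.false_of_inconsistent 3 3 (by decide +kernel)
              · exact h.false_of_M6 hN 3 3 ![1, 4, 6, 2, 5, 3, 0] (by decide +kernel)
          · rcases h.split {2, 4, 5} with h | h
            · exact h.false_of_inconsistent 3 3 (by decide +kernel)
            · rcases h.split {3, 4, 5} with h | h
              · exact h.false_of_inconsistent 3 3 (by decide +kernel)
              · exact h.false_of_M5 hN 3 3 ![1, 4, 6, 2, 5, 3, 0] (by decide +kernel)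
    · rcases h.split {1, 3, 5} with h | h
      · rcases h.split {2, 5, 6} with h | h
        · exact h.false_of_M4 hN 3 3 ![0, 1, 2, 6, 5, 3] (by decide +kernel)
        · rcases h.split {2, 3, 5} with h | h
          · exact h.false_of_inconsistent 3 3 (by decide +kernel)
          · rcases h.split {2, 4, 5} with h | h
            · rcases h.split {3, 4, 5} with h | h
              · exact h.false_of_inconsistent 3 3 (by decide +kernel)
              · exact h.false_of_M6 hN 3 3 ![0, 3, 6, 2, 5, 4, 1] (by decide +kernel)
            · rcases h.split {3, 4, 5} with h | h
              · exact h.false_of_inconsistent 3 3 (by decide +kernel)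
              · exact h.false_of_M5 hN 3 3 ![0, 3, 6, 2, 5, 4, 1] (by decide +kernel)
      · rcases h.split {2, 5, 6} with h | h
        · rcases h.split {2, 3, 5} with h | h
          · exact h.false_of_inconsistent 3 3 (by decide +kernel)
          · rcases h.split {2, 4, 5} with h | h
            · exact h.false_of_inconsistent 3 3 (by decide +kernel)
            · rcases h.split {3, 4, 5} with h | h
              · exact h.false_of_M6 hN 3 3 ![0, 1, 2, 3, 4, 5, 6] (by decide +kernel)
              · exact h.false_of_M5 hN 3 3 ![0, 1, 2, 3, 4, 5, 6] (by decide +kernel)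
        · rcases h.split {2, 3, 5} with h | h
          · rcases h.split {2, 4, 5} with h | h
            · exact h.false_of_inconsistent 3 3 (by decide +kernel)
            · rcases h.split {3, 4, 5} with h | h
              · exact h.false_of_inconsistent 3 3 (by decide +kernel)
              · exact h.false_of_M7 hN 3 3 ![1, 0, 2, 4, 3, 5, 6] (by decide +kernel)
          · rcases h.split {2, 4, 5} with h | h
            · rcases h.split {3, 4, 5} with h | h
              · exact h.false_of_inconsistent 3 3 (by decide +kernel)
              · exact h.false_of_M7 hN 3 3 ![0, 1, 2, 3, 4, 5, 6] (by decide +kernel)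
            · rcases h.split {3, 4, 5} with h | h
              · exact h.false_of_M7 hN 3 3 ![0, 6, 3, 2, 4, 5, 1] (by decide +kernel)
              · exact h.false_of_M8 hN 3 3 ![0, 1, 2, 3, 4, 5, 6] (by decide +kernel)

/-- Upper bounds on ranks for three-point lines `036`, `147`, `258` through the three points of
the line `012`, all in one plane. -/
def gridUpper : List (Finset (Fin 9) × ℕ) :=
  [({0, 1, 2}, 2), ({0, 3, 6}, 2), ({1, 4, 7}, 2), ({2, 5, 8}, 2), (Finset.univ, 3)]

/-- The lines of `gridUpper` have three points each, and the last three differ from the first. -/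
def gridLower : List (Finset (Fin 9)) :=
  [{0, 1, 3}, {0, 1, 4}, {0, 1, 5}, {0, 1, 6}, {0, 1, 7}, {0, 1, 8}, {0, 2, 3}, {1, 2, 3},
    {3, 6}, {4, 7}, {5, 8}]

/-- The columns `036` and `147` meet in `4`, so `0, 1, 4` are the corners of a triangle of
three-point lines. The third column provides the extra point `5` or `8`, unless these two lie on
different sides of the triangle, which gives `M₄`. -/
lemma Config.false_of_grid_meet_of_ne [N.RankFinite] {f : Fin 9 → α}
    (h : Config N f (({0, 3, 4, 6}, 2) :: gridUpper) ({3, 4} :: gridLower))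
    (hN : N.NoFigureMinor) : False := by
  rcases h.split {0, 4, 5} with h | h
  · rcases h.split {1, 4, 8} with h | h
    · rcases h.split {4, 5} with h | h
      · exact h.false_of_inconsistent 3 3 (by decide +kernel)
      · rcases h.split {4, 8} with h | h
        · exact h.false_of_inconsistent 3 3 (by decide +kernel)
        · exact h.false_of_M4 hN 3 3 ![0, 1, 2, 5, 8, 4] (by decide +kernel)
    · rcases h.split {0, 4, 8} with h | h
      · exact h.false_of_inconsistent 3 3 (by decide +kernel)
      · exact (h.reindex 3 3 ![0, 1, 2, 3, 7, 8, 4] (by decide +kernel)).false_of_triangle hN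
  · rcases h.split {1, 4, 5} with h | h
    · rcases h.split {0, 4, 8} with h | h
      · rcases h.split {4, 5} with h | h
        · exact h.false_of_inconsistent 3 3 (by decide +kernel)
        · rcases h.split {4, 8} with h | h
          · exact h.false_of_inconsistent 3 3 (by decide +kernel)
          · exact h.false_of_M4 hN 3 3 ![0, 1, 2, 8, 5, 4] (by decide +kernel)
      · rcases h.split {1, 4, 8} with h | h
        · exact h.false_of_inconsistent 3 3 (by decide +kernel)
        · exact (h.reindex 3 3 ![0, 1, 2, 3, 7, 8, 4] (by decide +kernel)).false_of_triangle hN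
    · exact (h.reindex 3 3 ![0, 1, 2, 3, 7, 5, 4] (by decide +kernel)).false_of_triangle hN

/-- The lines `036`, `147`, `258` of the grid are pairwise disjoint. -/
lemma Config.false_of_grid_meet [N.RankFinite] {f : Fin 9 → α}
    (h : Config N f (({0, 3, 4}, 2) :: gridUpper) gridLower)
    (hN : N.NoFigureMinor) : False := by
  have h := h.union 3 0 (A := {0, 3, 4}) (B := {0, 3, 6}) (a := 2) (b := 2)
    (by decide +kernel) (by decide +kernel) (by decide +kernel)
  rcases h.split {3, 4} with h | h
  -- Here `3` and `4` are parallel, so `6` and `4` are not, and exchanging `3` and `6` leads to the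
  -- other case.
  · have h := h.reindex 2 1 id (U' := ({0, 3, 4, 6}, 2) :: gridUpper)
      (G' := {4, 6} :: gridLower) (by decide +kernel)
    exact (h.reindex 3 1 ![0, 1, 2, 6, 4, 5, 3, 7, 8] (by decide +kernel)).false_of_grid_meet_of_ne
      hN
  · exact (h.reindex 3 0 id (by decide +kernel)).false_of_grid_meet_of_ne hN

/-- In addition to `gridLower`, no point of one of the lines `036`, `147`, `258` is on another. -/
def disjointGridLower : List (Finset (Fin 9)) :=
  [{0, 3, 4}, {0, 3, 7}, {0, 3, 5}, {0, 3, 8}, {1, 3, 4}, {1, 4, 6}, {1, 4, 5}, {1, 4, 8},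
    {2, 3, 5}, {2, 5, 6}, {2, 4, 5}, {2, 5, 7}] ++ gridLower

/-- In addition to `disjointGridLower`, the points `0, 1, 2` are on no further lines. -/
def properGridLower : List (Finset (Fin 9)) :=
  [{0, 4, 5}, {0, 4, 8}, {0, 5, 7}, {0, 7, 8}, {1, 3, 5}, {1, 3, 8}, {1, 5, 6}, {1, 6, 8},
    {2, 3, 4}, {2, 3, 7}, {2, 4, 6}, {2, 6, 7}] ++ disjointGridLower

/-- If one of the twelve triples is collinear, a point of one column lies on another column; after
relabelling, `4` lies on `036`. -/
lemma Config.disjoint_of_grid [N.RankFinite] {f : Fin 9 → α} (h : Config N f gridUpper gridLower)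
    (hN : N.NoFigureMinor) : Config N f gridUpper disjointGridLower := by
  replace h := (h.split {0, 3, 4}).resolve_left fun h =>
    (h.reindex 3 2 ![0, 1, 2, 3, 4, 5, 6, 7, 8] (by decide +kernel)).false_of_grid_meet hN
  replace h := (h.split {0, 3, 7}).resolve_left fun h =>
    (h.reindex 3 2 ![0, 1, 2, 3, 7, 5, 6, 4, 8] (by decide +kernel)).false_of_grid_meet hN
  replace h := (h.split {0, 3, 5}).resolve_left fun h =>
    (h.reindex 3 2 ![0, 2, 1, 3, 5, 4, 6, 8, 7] (by decide +kernel)).false_of_grid_meet hN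
  replace h := (h.split {0, 3, 8}).resolve_left fun h =>
    (h.reindex 3 2 ![0, 2, 1, 3, 8, 4, 6, 5, 7] (by decide +kernel)).false_of_grid_meet hN
  replace h := (h.split {1, 3, 4}).resolve_left fun h =>
    (h.reindex 3 2 ![1, 0, 2, 4, 3, 5, 7, 6, 8] (by decide +kernel)).false_of_grid_meet hN
  replace h := (h.split {1, 4, 6}).resolve_left fun h =>
    (h.reindex 3 2 ![1, 0, 2, 4, 6, 5, 7, 3, 8] (by decide +kernel)).false_of_grid_meet hN
  replace h := (h.split {1, 4, 5}).resolve_left fun h =>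
    (h.reindex 3 2 ![1, 2, 0, 4, 5, 3, 7, 8, 6] (by decide +kernel)).false_of_grid_meet hN
  replace h := (h.split {1, 4, 8}).resolve_left fun h =>
    (h.reindex 3 2 ![1, 2, 0, 4, 8, 3, 7, 5, 6] (by decide +kernel)).false_of_grid_meet hN
  replace h := (h.split {2, 3, 5}).resolve_left fun h =>
    (h.reindex 3 2 ![2, 0, 1, 5, 3, 4, 8, 6, 7] (by decide +kernel)).false_of_grid_meet hN
  replace h := (h.split {2, 5, 6}).resolve_left fun h =>
    (h.reindex 3 2 ![2, 0, 1, 5, 6, 4, 8, 3, 7] (by decide +kernel)).false_of_grid_meet hN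
  replace h := (h.split {2, 4, 5}).resolve_left fun h =>
    (h.reindex 3 2 ![2, 1, 0, 5, 4, 3, 8, 7, 6] (by decide +kernel)).false_of_grid_meet hN
  replace h := (h.split {2, 5, 7}).resolve_left fun h =>
    (h.reindex 3 2 ![2, 1, 0, 5, 7, 3, 8, 4, 6] (by decide +kernel)).false_of_grid_meet hN
  exact h.reindex 3 0 id (by decide +kernel)

/-- A further line through one of `0, 1, 2` that meets the other two columns forms a triangle with
the bottom line and one of those columns. A point of the remaining column is off this triangle. -/
lemma Config.proper_of_grid [N.RankFinite] {f : Fin 9 → α}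
    (h : Config N f gridUpper disjointGridLower) (hN : N.NoFigureMinor) :
    Config N f gridUpper properGridLower := by
  replace h := (h.split {0, 4, 5}).resolve_left fun h =>
    (h.reindex 3 1 ![0, 1, 2, 5, 7, 3, 4] (by decide +kernel)).false_of_triangle hN
  replace h := (h.split {0, 4, 8}).resolve_left fun h =>
    (h.reindex 3 1 ![0, 1, 2, 8, 7, 3, 4] (by decide +kernel)).false_of_triangle hN
  replace h := (h.split {0, 5, 7}).resolve_left fun h =>
    (h.reindex 3 1 ![0, 1, 2, 5, 4, 3, 7] (by decide +kernel)).false_of_triangle hN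
  replace h := (h.split {0, 7, 8}).resolve_left fun h =>
    (h.reindex 3 1 ![0, 1, 2, 8, 4, 3, 7] (by decide +kernel)).false_of_triangle hN
  replace h := (h.split {1, 3, 5}).resolve_left fun h =>
    (h.reindex 3 1 ![1, 0, 2, 5, 6, 4, 3] (by decide +kernel)).false_of_triangle hN
  replace h := (h.split {1, 3, 8}).resolve_left fun h =>
    (h.reindex 3 1 ![1, 0, 2, 8, 6, 4, 3] (by decide +kernel)).false_of_triangle hN
  replace h := (h.split {1, 5, 6}).resolve_left fun h =>
    (h.reindex 3 1 ![1, 0, 2, 5, 3, 4, 6] (by decide +kernel)).false_of_triangle hN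
  replace h := (h.split {1, 6, 8}).resolve_left fun h =>
    (h.reindex 3 1 ![1, 0, 2, 8, 3, 4, 6] (by decide +kernel)).false_of_triangle hN
  replace h := (h.split {2, 3, 4}).resolve_left fun h =>
    (h.reindex 3 1 ![2, 0, 1, 4, 6, 5, 3] (by decide +kernel)).false_of_triangle hN
  replace h := (h.split {2, 3, 7}).resolve_left fun h =>
    (h.reindex 3 1 ![2, 0, 1, 7, 6, 5, 3] (by decide +kernel)).false_of_triangle hN
  replace h := (h.split {2, 4, 6}).resolve_left fun h =>
    (h.reindex 3 1 ![2, 0, 1, 4, 3, 5, 6] (by decide +kernel)).false_of_triangle hN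
  replace h := (h.split {2, 6, 7}).resolve_left fun h =>
    (h.reindex 3 1 ![2, 0, 1, 7, 3, 5, 6] (by decide +kernel)).false_of_triangle hN
  exact h.reindex 3 0 id (by decide +kernel)

/-- Two lines that meet in a point and meet each of `036`, `147`, `258` give a triangle. -/
lemma Config.false_of_grid_transversals [N.RankFinite] {f : Fin 9 → α}
    (h : Config N f (({3, 7, 8}, 2) :: ({3, 4, 5}, 2) :: gridUpper) properGridLower)
    (hN : N.NoFigureMinor) : False :=
  (h.reindex 3 1 ![3, 4, 5, 8, 1, 0, 7] (by decide +kernel)).false_of_triangle hN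

lemma Config.false_of_grid_transversal [N.RankFinite] {f : Fin 9 → α}
    (h : Config N f (({3, 4, 5}, 2) :: gridUpper) properGridLower)
    (hN : N.NoFigureMinor) : False := by
  -- Another transversal either misses `3, 4, 5`, which leaves only `678`, or meets `345` in exactly
  -- one point, which leaves the three triples below. Two common points would force the transversals
  -- to agree.
  rcases h.split {6, 7, 8} with h | h
  · exact h.false_of_M3 hN 3 2 id (by decide +kernel)
  rcases h.split {3, 7, 8} with h | h
  · exact (h.reindex 3 0 id (by decide +kernel)).false_of_grid_transversals hN
  rcases h.split {4, 6, 8} with h | h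
  · exact (h.reindex 3 1 ![1, 0, 2, 4, 3, 5, 7, 6, 8] (by decide +kernel)).false_of_grid_transversals
      hN
  rcases h.split {5, 6, 7} with h | h
  · exact (h.reindex 3 1 ![2, 1, 0, 5, 4, 3, 8, 7, 6] (by decide +kernel)).false_of_grid_transversals
      hN
  exact h.false_of_M2 hN 3 2 id (by decide +kernel)

/-- Three three-point lines through the points of a three-point line in a plane yield one of
`M₁, …, M₈`. -/
theorem Config.false_of_grid [N.RankFinite] {f : Fin 9 → α} (h : Config N f gridUpper gridLower)
    (hN : N.NoFigureMinor) : False := by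
  replace h := (h.disjoint_of_grid hN).proper_of_grid hN
  replace h := (h.split {3, 4, 5}).resolve_left fun h =>
    (h.reindex 3 2 ![0, 1, 2, 3, 4, 5, 6, 7, 8] (by decide +kernel)).false_of_grid_transversal hN
  replace h := (h.split {3, 4, 8}).resolve_left fun h =>
    (h.reindex 3 2 ![0, 1, 2, 3, 4, 8, 6, 7, 5] (by decide +kernel)).false_of_grid_transversal hN
  replace h := (h.split {3, 5, 7}).resolve_left fun h =>
    (h.reindex 3 2 ![0, 1, 2, 3, 7, 5, 6, 4, 8] (by decide +kernel)).false_of_grid_transversal hN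
  replace h := (h.split {3, 7, 8}).resolve_left fun h =>
    (h.reindex 3 2 ![0, 1, 2, 3, 7, 8, 6, 4, 5] (by decide +kernel)).false_of_grid_transversal hN
  replace h := (h.split {4, 5, 6}).resolve_left fun h =>
    (h.reindex 3 2 ![0, 1, 2, 6, 4, 5, 3, 7, 8] (by decide +kernel)).false_of_grid_transversal hN
  replace h := (h.split {4, 6, 8}).resolve_left fun h =>
    (h.reindex 3 2 ![0, 1, 2, 6, 4, 8, 3, 7, 5] (by decide +kernel)).false_of_grid_transversal hN
  replace h := (h.split {5, 6, 7}).resolve_left fun h =>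
    (h.reindex 3 2 ![0, 1, 2, 6, 7, 5, 3, 4, 8] (by decide +kernel)).false_of_grid_transversal hN
  replace h := (h.split {6, 7, 8}).resolve_left fun h =>
    (h.reindex 3 2 ![0, 1, 2, 6, 7, 8, 3, 4, 5] (by decide +kernel)).false_of_grid_transversal hN
  exact h.false_of_M1 hN 3 2 id (by decide +kernel)

/-- Upper bounds on ranks for a line `012` in three planes, each containing a further three-point
line. -/
def spaceUpper : List (Finset (Fin 9) × ℕ) :=
  [({0, 1, 2}, 2), ({0, 3, 4}, 2), ({1, 5, 6}, 2), ({2, 7, 8}, 2), ({0, 1, 2, 3, 4}, 3),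
    ({0, 1, 2, 5, 6}, 3), ({0, 1, 2, 7, 8}, 3), (Finset.univ, 4)]

/-- The planes of `spaceUpper` are different. -/
def spaceLower : List (Finset (Fin 9)) :=
  [{0, 1, 3, 5}, {0, 1, 3, 7}, {0, 1, 5, 7}, {0, 2}, {1, 2}, {0, 4}, {3, 4}, {1, 6}, {5, 6},
    {2, 8}, {7, 8}]

/-- The lines `012`, `034`, `156`, `235` form a copy of `M₄` with one point possibly replaced: if
`6` is on the line `034` it is the missing corner, and otherwise `6` is an extra point for the
triangle with corners `0, 2, 3`. -/
lemma Config.false_of_contracted_space [N.RankFinite] {f : Fin 7 → α}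
    (h : Config N f [({0, 1, 2}, 2), ({0, 3, 4}, 2), ({1, 5, 6}, 2), ({2, 3, 5}, 2),
      (Finset.univ, 3)] [{0, 1, 3}, {0, 1, 5}, {3, 5}, {0, 2}, {1, 2}, {0, 4}, {3, 4}, {1, 6},
      {5, 6}, {0, 2, 3}, {1, 2, 3}, {0, 2, 5}])
    (hN : N.NoFigureMinor) : False := by
  rcases h.split {0, 3, 6} with h | h
  · exact h.false_of_M4 hN 3 3 ![0, 1, 2, 3, 5, 6] (by decide +kernel)
  · exact (h.reindex 3 3 ![0, 2, 1, 4, 5, 6, 3] (by decide +kernel)).false_of_triangle hN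

/-- Contracting `7` makes `2, 3, 5` collinear and leaves the lines `012`, `034`, `156` in a plane.
-/
lemma Config.false_of_space_meet_of_not_collinear [N.RankFinite] {f : Fin 9 → α}
    (h : Config N f (({2, 3, 5, 7, 8}, 3) :: spaceUpper) ({3, 5, 7} :: spaceLower))
    (hN : N.NoFigureMinor) : False :=
  (h.contract 4 2 7 ![0, 1, 2, 3, 4, 5, 6] (by decide +kernel)).false_of_contracted_space
    (hN.isMinor (N.contract_isMinor' _))

/-- The points `3, 5` cannot be collinear with both `7` and `8`, so after exchanging `7` and `8` if
necessary, `3, 5, 7` are not collinear. -/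
lemma Config.false_of_space_meet [N.RankFinite] {f : Fin 9 → α}
    (h : Config N f (({2, 3, 5, 7}, 3) :: spaceUpper) spaceLower)
    (hN : N.NoFigureMinor) : False := by
  have h := h.union 4 2 (A := {2, 3, 5, 7}) (B := {2, 7, 8}) (a := 3) (b := 2)
    (by decide +kernel) (by decide +kernel) (by decide +kernel)
  rcases h.split {3, 5, 7} with h | h
  · have h := h.reindex 4 2 id (U' := ({3, 5, 7}, 2) :: ({2, 3, 5, 7, 8}, 3) :: spaceUpper)
      (G' := {2, 3, 5} :: {2, 3, 7} :: spaceLower) (by decide +kernel)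
    have h := h.reindex 3 3 id (U' := ({2, 3, 5, 7, 8}, 3) :: spaceUpper)
      (G' := {3, 5, 8} :: spaceLower)
    exact (h (by decide +kernel)).reindex 4 4 ![0, 1, 2, 3, 4, 5, 6, 8, 7]
      (by decide +kernel) |>.false_of_space_meet_of_not_collinear hN
  · exact (h.reindex 4 0 id (by decide +kernel)).false_of_space_meet_of_not_collinear hN

/-- Three-point lines through the points of a three-point line in three different planes of a
rank-four matroid yield one of `M₄, …, M₉`. -/
theorem Config.false_of_space [N.RankFinite] {f : Fin 9 → α} (h : Config N f spaceUpper spaceLower)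
    (hN : N.NoFigureMinor) : False := by
  -- In `M₉` one of `0, 1, 2` together with one point from each of `34`, `56`, `78` is a basis. Next
  -- to `0` the points `3` and `4` are interchangeable, since `034` is a line, and similarly for `1`
  -- and `2`; so twelve of these sets suffice. The remaining bases are derived from them.
  replace h := (h.split {0, 3, 5, 7}).resolve_left fun h =>
    (h.reindex 4 3 ![1, 2, 0, 5, 6, 7, 8, 3, 4] (by decide +kernel)).false_of_space_meet hN
  replace h := (h.split {0, 3, 5, 8}).resolve_left fun h =>
    (h.reindex 4 3 ![1, 2, 0, 5, 6, 8, 7, 3, 4] (by decide +kernel)).false_of_space_meet hN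
  replace h := (h.split {0, 3, 6, 7}).resolve_left fun h =>
    (h.reindex 4 3 ![1, 2, 0, 6, 5, 7, 8, 3, 4] (by decide +kernel)).false_of_space_meet hN
  replace h := (h.split {0, 3, 6, 8}).resolve_left fun h =>
    (h.reindex 4 3 ![1, 2, 0, 6, 5, 8, 7, 3, 4] (by decide +kernel)).false_of_space_meet hN
  replace h := (h.split {1, 3, 5, 7}).resolve_left fun h =>
    (h.reindex 4 3 ![0, 2, 1, 3, 4, 7, 8, 5, 6] (by decide +kernel)).false_of_space_meet hN
  replace h := (h.split {1, 3, 5, 8}).resolve_left fun h =>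
    (h.reindex 4 3 ![0, 2, 1, 3, 4, 8, 7, 5, 6] (by decide +kernel)).false_of_space_meet hN
  replace h := (h.split {1, 4, 5, 7}).resolve_left fun h =>
    (h.reindex 4 3 ![0, 2, 1, 4, 3, 7, 8, 5, 6] (by decide +kernel)).false_of_space_meet hN
  replace h := (h.split {1, 4, 5, 8}).resolve_left fun h =>
    (h.reindex 4 3 ![0, 2, 1, 4, 3, 8, 7, 5, 6] (by decide +kernel)).false_of_space_meet hN
  replace h := (h.split {2, 3, 5, 7}).resolve_left fun h =>
    (h.reindex 4 3 ![0, 1, 2, 3, 4, 5, 6, 7, 8] (by decide +kernel)).false_of_space_meet hN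
  replace h := (h.split {2, 3, 6, 7}).resolve_left fun h =>
    (h.reindex 4 3 ![0, 1, 2, 3, 4, 6, 5, 7, 8] (by decide +kernel)).false_of_space_meet hN
  replace h := (h.split {2, 4, 5, 7}).resolve_left fun h =>
    (h.reindex 4 3 ![0, 1, 2, 4, 3, 5, 6, 7, 8] (by decide +kernel)).false_of_space_meet hN
  replace h := (h.split {2, 4, 6, 7}).resolve_left fun h =>
    (h.reindex 4 3 ![0, 1, 2, 4, 3, 6, 5, 7, 8] (by decide +kernel)).false_of_space_meet hN
  exact h.false_of_rankFour hN 4 3 id (by decide +kernel)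

end FigureConfigurations

/-! ### Inseparable (connected) matroids and their inseparable minors. -/

section Inseparable

variable {α : Type*} {M N : Matroid α} {A B X Y Z : Set α} {e : α}

/-- A matroid is inseparable if its ground set is not the union of two nonempty disjoint sets
whose ranks add up to the rank of the matroid. -/
def IsInseparable (N : Matroid α) : Prop :=
  ∀ A ⊆ N.E, A.Nonempty → (N.E \ A).Nonempty → N.rk N.E < N.rk A + N.rk (N.E \ A)

/-- Rank additivity passes to subsets of the two sides: shrink first `B`, then `A`, by
submodularity. -/
lemma rk_add_rk_le_of_separation [N.RankFinite] (h : N.rk A + N.rk B ≤ N.rk (A ∪ B)) (hX : X ⊆ A)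
    (hY : Y ⊆ B) : N.rk X + N.rk Y ≤ N.rk (X ∪ Y) := by
  have h1 := N.rk_submod (X ∪ Y) A
  have h2 := N.rk_submod (Y ∪ A) B
  have h3 : N.rk X ≤ N.rk ((X ∪ Y) ∩ A) := N.rk_mono fun x hx => ⟨Or.inl hx, hX hx⟩
  have h4 : N.rk (Y ∪ A) ≤ N.rk ((X ∪ Y) ∪ A) := N.rk_mono fun x hx =>
    hx.elim (fun h => Or.inl (Or.inr h)) Or.inr
  have h5 : N.rk Y ≤ N.rk ((Y ∪ A) ∩ B) := N.rk_mono fun x hx => ⟨Or.inl hx, hY hx⟩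
  have h6 : N.rk (A ∪ B) ≤ N.rk ((Y ∪ A) ∪ B) := N.rk_mono fun x hx =>
    hx.elim (fun h => Or.inl (Or.inr h)) Or.inr
  omega

/-- Here `A, B` separate the deletion of `e` and `C, D` separate its contraction. Submodularity for
`A, C ∪ {e}` and for `B, D ∪ {e}` bounds four ranks by `2r + 1` in total. They pair up into `A ∩ C`
and `B ∩ D` with their complements, so inseparability makes their sum at least `2r + 2`. -/
lemma IsInseparable.false_of_uncross [N.RankFinite] (h : N.IsInseparable) (he : e ∈ N.E)
    {A B C D : Set α} (hAB : N.E = insert e (A ∪ B)) (hCD : N.E = insert e (C ∪ D))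
    (heA : e ∉ A) (heB : e ∉ B) (hdAB : Disjoint A B)
    (hdCD : Disjoint C D) (h1 : N.rk A + N.rk B ≤ N.rk N.E)
    (h2 : N.rk (insert e C) + N.rk (insert e D) ≤ N.rk N.E + 1)
    (hAC : (A ∩ C).Nonempty) (hBD : (B ∩ D).Nonempty) : False := by
  have hs1 := N.rk_submod A (insert e C)
  have hs2 := N.rk_submod B (insert e D)
  have key : ∀ x, x ∈ N.E ↔ x = e ∨ x ∈ A ∨ x ∈ B := fun x => by rw [hAB]; simp
  have key' : ∀ x, x ∈ N.E ↔ x = e ∨ x ∈ C ∨ x ∈ D := fun x => by rw [hCD]; simp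
  have hdAB' : ∀ x ∈ A, x ∉ B := fun x hx => Set.disjoint_left.1 hdAB hx
  have hdCD' : ∀ x ∈ C, x ∉ D := fun x hx => Set.disjoint_left.1 hdCD hx
  have e1 : A ∩ insert e C = A ∩ C := by
    ext x
    simp only [Set.mem_inter_iff, Set.mem_insert_iff]
    grind
  have e2 : B ∩ insert e D = B ∩ D := by
    ext x
    simp only [Set.mem_inter_iff, Set.mem_insert_iff]
    grind
  have e3 : N.E \ (A ∩ C) = B ∪ insert e D := by
    ext x
    simp only [Set.mem_sdiff, Set.mem_inter_iff, Set.mem_union, Set.mem_insert_iff]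
    grind
  have e4 : N.E \ (B ∩ D) = A ∪ insert e C := by
    ext x
    simp only [Set.mem_sdiff, Set.mem_inter_iff, Set.mem_union, Set.mem_insert_iff]
    grind
  have h3 := h (A ∩ C) (fun x hx => (key x).2 (Or.inr (Or.inl hx.1))) hAC
    ⟨e, he, fun h => heA h.1⟩
  have h4 := h (B ∩ D) (fun x hx => (key x).2 (Or.inr (Or.inr hx.1))) hBD
    ⟨e, he, fun h => heB h.1⟩
  rw [e3] at h3
  rw [e4] at h4
  rw [e1] at hs1
  rw [e2] at hs2
  omega

/-- Deleting or contracting an element of an inseparable matroid leaves it inseparable. -/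
theorem IsInseparable.delete_or_contract [N.RankFinite] (h : N.IsInseparable) (he : e ∈ N.E) :
    (N ↾ (N.E \ {e})).IsInseparable ∨ (N ／ {e}).IsInseparable := by
  by_contra! hcon
  obtain ⟨h1, h2⟩ := hcon
  simp only [IsInseparable, not_forall, not_lt] at h1 h2
  obtain ⟨A, hA, hAn, hBn, hAB⟩ := h1
  obtain ⟨C, hC, hCn, hDn, hCD⟩ := h2
  rw [restrict_ground_eq] at hA hBn hAB
  rw [contract_ground] at hC hDn hCD
  rw [rk_restrict _ hA, rk_restrict _ Set.sdiff_subset, rk_restrict _ subset_rfl] at hAB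
  have h3 := N.rk_contract_add {e} C
  have h4 := N.rk_contract_add {e} ((N.E \ {e}) \ C)
  have h5 := N.rk_contract_add {e} (N.E \ {e})
  rw [Set.sdiff_union_of_subset (Set.singleton_subset_iff.2 he)] at h5
  rw [Set.union_singleton] at h3 h4
  have h6 := N.rk_singleton_le e
  have h7 : N.rk (N.E \ {e}) ≤ N.rk N.E := N.rk_mono Set.sdiff_subset
  have e1 : ∀ X ⊆ N.E \ {e}, N.E = insert e (X ∪ ((N.E \ {e}) \ X)) := fun X hX => by
    rw [Set.union_sdiff_cancel hX, Set.insert_sdiff_singleton, Set.insert_eq_of_mem he]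
  have e2 : ∀ X : Set α, e ∉ (N.E \ {e}) \ X := fun X h => h.1.2 rfl
  -- If one of these intersections is empty, both become nonempty after exchanging `C` with its
  -- complement.
  by_cases hx : (A ∩ C).Nonempty ∧ (((N.E \ {e}) \ A) ∩ ((N.E \ {e}) \ C)).Nonempty
  · exact h.false_of_uncross he (e1 A hA) (e1 C hC) (fun h => (hA h).2 rfl) (e2 A)
      Set.disjoint_sdiff_right Set.disjoint_sdiff_right
      (by omega) (by omega) hx.1 hx.2
  · refine h.false_of_uncross he (e1 A hA) (by rw [Set.union_comm]; exact e1 C hC)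
      (fun h => (hA h).2 rfl) (e2 A) Set.disjoint_sdiff_right
      Set.disjoint_sdiff_left (by omega) (by omega) ?_ ?_
    · by_contra hne
      rw [Set.not_nonempty_iff_eq_empty] at hne
      have hAC : A ⊆ C := fun x hx => by
        by_contra hxC
        exact (Set.eq_empty_iff_forall_notMem.1 hne x) ⟨hx, hA hx, hxC⟩
      refine hx ⟨hAn.mono fun x hx => ⟨hx, hAC hx⟩, hDn.mono fun x hx => ⟨⟨hx.1, fun h =>
        hx.2 (hAC h)⟩, hx⟩⟩
    · by_contra hne
      rw [Set.not_nonempty_iff_eq_empty] at hne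
      have hCA : C ⊆ A := fun x hx => by
        by_contra hxA
        exact (Set.eq_empty_iff_forall_notMem.1 hne x) ⟨⟨hC hx, hxA⟩, hx⟩
      refine hx ⟨hCn.mono fun x hx => ⟨hCA hx, hx⟩, hBn.mono fun x hx => ⟨hx, hx.1, fun h =>
        hx.2 (hCA h)⟩⟩

/-- An inseparable matroid has an inseparable minor on any given nonempty set of elements. -/
theorem IsInseparable.exists_contract_restrict [N.Finite] (h : N.IsInseparable) (hZ : Z ⊆ N.E) :
    ∃ C ⊆ N.E \ Z, ((N ／ C) ↾ Z).IsInseparable := by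
  obtain ⟨n, hn⟩ : ∃ n, (N.E \ Z).ncard = n := ⟨_, rfl⟩
  induction n using Nat.strong_induction_on generalizing N with
  | _ n ih =>
    rcases (N.E \ Z).eq_empty_or_nonempty with h0 | ⟨e, heE, heZ⟩
    · refine ⟨∅, Set.empty_subset _, ?_⟩
      rw [contract_empty, Set.Subset.antisymm hZ (Set.sdiff_eq_empty.1 h0), restrict_ground_eq_self]
      exact h
    · have hZe : Z ⊆ N.E \ {e} := fun x hx => ⟨hZ hx, fun h => heZ (h ▸ hx)⟩
      have hlt : ((N.E \ {e}) \ Z).ncard < n := by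
        rw [← hn]
        refine Set.ncard_lt_ncard ⟨Set.sdiff_subset_sdiff_left Set.sdiff_subset, fun h => ?_⟩
          (N.ground_finite.sdiff)
        exact (h ⟨heE, heZ⟩).1.2 rfl
      rcases h.delete_or_contract heE with h1 | h1
      · have : (N ↾ (N.E \ {e})).Finite := restrict_finite N.ground_finite.sdiff
        obtain ⟨C, hC, h2⟩ := ih _ hlt h1 hZe rfl
        rw [restrict_ground_eq] at hC
        refine ⟨C, fun x hx => ⟨(hC hx).1.1, (hC hx).2⟩, ?_⟩
        rwa [restrict_contract_eq_contract_restrict _ (hC.trans Set.sdiff_subset),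
          restrict_restrict_eq] at h2
        exact fun x hx => ⟨hZe hx, fun h => (hC h).2 hx⟩
      · obtain ⟨C, hC, h2⟩ := ih _ hlt h1 hZe rfl
        rw [contract_ground] at hC
        rw [contract_contract] at h2
        refine ⟨_, ?_, h2⟩
        rintro x (rfl | hx)
        · exact ⟨heE, heZ⟩
        · exact ⟨(hC hx).1.1, (hC hx).2⟩

/-- The contracted set in `exists_contract_restrict` can be taken to be independent. -/
theorem IsInseparable.exists_indep_contract_restrict [N.Finite] (h : N.IsInseparable)
    (hZ : Z ⊆ N.E) : ∃ C ⊆ N.E \ Z, N.Indep C ∧ ((N ／ C) ↾ Z).IsInseparable := by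
  obtain ⟨C, hC, h1⟩ := h.exists_contract_restrict hZ
  -- Contracting `C` amounts to contracting a basis of `C` and deleting its other elements, which
  -- are not in `Z`.
  obtain ⟨I, hI⟩ := N.exists_isBasis C (hC.trans Set.sdiff_subset)
  refine ⟨I, hI.subset.trans hC, hI.indep, ?_⟩
  rwa [hI.contract_eq_contract_delete, delete_eq_restrict, restrict_restrict_eq] at h1
  exact fun x hx => ⟨⟨hZ hx, fun h => (hC (hI.subset h)).2 hx⟩, fun h => (hC h.1).2 hx⟩

end Inseparable

/-! ### Lines, long lines, and reduction of three lines through a line to the configurations. -/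

section Lines

variable {α : Type*} {M N : Matroid α} {K L X Y Z : Set α} {a b c e f x y : α}

/-- A line is a flat of rank two. -/
def IsLine (M : Matroid α) (L : Set α) : Prop := M.IsFlat L ∧ M.rk L = 2

/-- A long line is a line with at least three points. -/
def IsLongLine (M : Matroid α) (L : Set α) : Prop := M.IsLine L ∧ 3 ≤ L.ncard

lemma IsLine.subset_ground (h : M.IsLine L) : L ⊆ M.E := h.1.subset_ground

lemma isLine_closure_pair [M.RankFinite] (hM : M.IsSimple) (ha : a ∈ M.E) (hb : b ∈ M.E)
    (hab : a ≠ b) : M.IsLine (M.closure {a, b}) :=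
  ⟨M.isFlat_closure _, by rw [rk_closure, hM.rk_pair ha hb hab]⟩

lemma IsLine.subset_closure_pair [M.RankFinite] (h : M.IsLine L) (hM : M.IsSimple) (ha : a ∈ L)
    (hb : b ∈ L) (hab : a ≠ b) : L ⊆ M.closure {a, b} :=
  subset_closure_of_rk_le h.subset_ground (Set.pair_subset ha hb) (by
    rw [h.2, hM.rk_pair (h.subset_ground ha) (h.subset_ground hb) hab])

lemma IsLine.closure_pair_eq [M.RankFinite] (h : M.IsLine L) (hM : M.IsSimple) (ha : a ∈ L)
    (hb : b ∈ L) (hab : a ≠ b) : M.closure {a, b} = L :=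
  ((M.closure_subset_closure (Set.pair_subset ha hb)).trans h.1.closure.subset).antisymm
    (h.subset_closure_pair hM ha hb hab)

lemma IsLine.eq_of_mem [M.RankFinite] (h : M.IsLine L) (h' : M.IsLine K) (hM : M.IsSimple)
    (ha : a ∈ L) (hb : b ∈ L) (ha' : a ∈ K) (hb' : b ∈ K) (hab : a ≠ b) : L = K := by
  rw [← h.closure_pair_eq hM ha hb hab, h'.closure_pair_eq hM ha' hb' hab]

lemma IsLine.restrict (h : M.IsLine L) (hX : X ⊆ M.E) (hL : L ⊆ X) : (M ↾ X).IsLine L :=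
  ⟨isFlat_restrict h.1 hL hX, by rw [rk_restrict _ hL, h.2]⟩

lemma IsLongLine.restrict (h : M.IsLongLine L) (hX : X ⊆ M.E) (hL : L ⊆ X) :
    (M ↾ X).IsLongLine L :=
  ⟨h.1.restrict hX hL, h.2⟩

lemma exists_mem_ne_ne_of_three_le_ncard (h : 3 ≤ L.ncard) (a b : α) :
    ∃ c ∈ L, c ≠ a ∧ c ≠ b := by
  by_contra! hcon
  have h1 : L ⊆ {a, b} := fun x hx => by
    by_cases hxa : x = a
    · exact Or.inl hxa
    · exact Or.inr (hcon x hx hxa)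
  have h2 := Set.ncard_le_ncard h1 (Set.toFinite _)
  have h3 := Set.ncard_insert_le a {b}
  rw [Set.ncard_singleton] at h3
  omega

lemma rk_contract_le_of_subset_closure [M.RankFinite] {C : Set α} (h : Y ⊆ M.closure X) :
    (M ／ C).rk Y ≤ (M ／ C).rk X := by
  have h1 := M.rk_contract_add C X
  have h2 := M.rk_contract_add C Y
  have h3 := rk_le_rk_union_of_subset_closure (Z := C) h
  omega

lemma rk_contract_le [M.RankFinite] (C X : Set α) : (M ／ C).rk X ≤ M.rk X := by
  have h1 := M.rk_contract_add C X
  have h2 := M.rk_union_le X C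
  omega

/-- Three-point lines through the points of a three-point line that are pairwise equal or
independent after contraction of that line yield one of the nine excluded minors. -/
lemma false_of_columns [N.RankFinite] (hN : N.NoFigureMinor) (p z w : Fin 3 → α)
    (hp : ∀ i, p i ∈ N.E) (hz : ∀ i, z i ∈ N.E) (hw : ∀ i, w i ∈ N.E)
    (hL : N.rk {p 0, p 1, p 2} ≤ 2) (hK : ∀ i, N.rk {p i, z i, w i} ≤ 2)
    (hpp : ∀ i j, i ≠ j → 2 ≤ N.rk {p i, p j}) (hpz : ∀ i, 2 ≤ N.rk {p i, z i})
    (hpw : ∀ i, 2 ≤ N.rk {p i, w i}) (hzw : ∀ i, 2 ≤ N.rk {z i, w i})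
    (hLz : ∀ i, 3 ≤ N.rk {p 0, p 1, z i})
    (h : N.rk {p 0, p 1, p 2, z 0, z 1, z 2} ≤ 3 ∨
      N.rk {p 0, p 1, p 2, z 0, z 1, z 2} ≤ 4 ∧
        ∀ i j, i ≠ j → 4 ≤ N.rk {p 0, p 1, z i, z j}) : False := by
  set f : Fin 9 → α := ![p 0, p 1, p 2, z 0, z 1, z 2, w 0, w 1, w 2] with hf
  have hmem : ∀ i, f i ∈ N.E := by
    intro i
    fin_cases i
    exacts [hp 0, hp 1, hp 2, hz 0, hz 1, hz 2, hw 0, hw 1, hw 2]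
  rcases h with h | ⟨h, h4⟩
  · have hc : Config N f [({0, 1, 2}, 2), ({0, 3, 6}, 2), ({1, 4, 7}, 2), ({2, 5, 8}, 2),
        ({0, 1, 2, 3, 4, 5}, 3)] [{0, 1, 3}, {0, 1, 4}, {0, 1, 5}, {0, 2}, {1, 2}, {0, 6}, {3, 6},
        {1, 7}, {4, 7}, {2, 5}, {2, 8}, {5, 8}] := by
      refine ⟨hmem, ?_, ?_⟩
      · simp only [List.forall_mem_cons, List.not_mem_nil, false_imp_iff, implies_true, and_true,
          Finset.coe_insert, Finset.coe_singleton, Set.image_insert_eq, Set.image_singleton]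
        exact ⟨hL, hK 0, hK 1, hK 2, h⟩
      · simp only [List.forall_mem_cons, List.not_mem_nil, false_imp_iff, implies_true, and_true,
          Finset.coe_insert, Finset.coe_singleton, Set.image_insert_eq, Set.image_singleton]
        exact ⟨hLz 0, hLz 1, hLz 2, hpp 0 2 (by decide), hpp 1 2 (by decide), hpw 0, hzw 0, hpw 1,
          hzw 1, hpz 2, hpw 2, hzw 2⟩
    -- The point `w i` lies on the line of `p i` and `z i`, so adding the three columns does not
    -- raise the rank.
    have hc := hc.union 3 0 (A := {0, 1, 2, 3, 4, 5}) (B := {0, 3, 6}) (a := 3) (b := 2)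
      (by decide +kernel) (by decide +kernel) (by decide +kernel)
    have hc := hc.union 3 0 (A := {0, 1, 2, 3, 4, 5, 6}) (B := {1, 4, 7}) (a := 3) (b := 2)
      (by decide +kernel) (by decide +kernel) (by decide +kernel)
    have hc := hc.union 3 0 (A := {0, 1, 2, 3, 4, 5, 6, 7}) (B := {2, 5, 8}) (a := 3) (b := 2)
      (by decide +kernel) (by decide +kernel) (by decide +kernel)
    exact (hc.reindex 3 3 id (by decide +kernel)).false_of_grid hN
  · have hc : Config N f [({0, 1, 2}, 2), ({0, 3, 6}, 2), ({1, 4, 7}, 2), ({2, 5, 8}, 2),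
        ({0, 1, 2, 3, 4, 5}, 4)] [{0, 1, 3, 4}, {0, 1, 3, 5}, {0, 1, 4, 5}, {0, 2}, {1, 2}, {0, 6},
        {3, 6}, {1, 7}, {4, 7}, {2, 5}, {2, 8}, {5, 8}] := by
      refine ⟨hmem, ?_, ?_⟩
      · simp only [List.forall_mem_cons, List.not_mem_nil, false_imp_iff, implies_true, and_true,
          Finset.coe_insert, Finset.coe_singleton, Set.image_insert_eq, Set.image_singleton]
        exact ⟨hL, hK 0, hK 1, hK 2, h⟩
      · simp only [List.forall_mem_cons, List.not_mem_nil, false_imp_iff, implies_true, and_true,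
          Finset.coe_insert, Finset.coe_singleton, Set.image_insert_eq, Set.image_singleton]
        exact ⟨h4 0 1 (by decide), h4 0 2 (by decide), h4 1 2 (by decide), hpp 0 2 (by decide),
          hpp 1 2 (by decide), hpw 0, hzw 0, hpw 1, hzw 1, hpz 2, hpw 2, hzw 2⟩
    have hc := hc.union 4 0 (A := {0, 1, 2, 3, 4, 5}) (B := {0, 3, 6}) (a := 4) (b := 2)
      (by decide +kernel) (by decide +kernel) (by decide +kernel)
    have hc := hc.union 4 0 (A := {0, 1, 2, 3, 4, 5, 6}) (B := {1, 4, 7}) (a := 4) (b := 2)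
      (by decide +kernel) (by decide +kernel) (by decide +kernel)
    have hc := hc.union 4 0 (A := {0, 1, 2, 3, 4, 5, 6, 7}) (B := {2, 5, 8}) (a := 4) (b := 2)
      (by decide +kernel) (by decide +kernel) (by decide +kernel)
    -- The next bounds are the three planes, each spanned by the line `012` and one column.
    have hc := hc.union 4 0 (A := {0, 1, 2}) (B := {0, 3, 6}) (a := 2) (b := 2)
      (by decide +kernel) (by decide +kernel) (by decide +kernel)
    have hc := hc.union 4 0 (A := {0, 1, 2}) (B := {1, 4, 7}) (a := 2) (b := 2)
      (by decide +kernel) (by decide +kernel) (by decide +kernel)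
    have hc := hc.union 4 0 (A := {0, 1, 2}) (B := {2, 5, 8}) (a := 2) (b := 2)
      (by decide +kernel) (by decide +kernel) (by decide +kernel)
    exact (hc.reindex 4 2 ![0, 1, 2, 3, 6, 4, 7, 5, 8] (by decide +kernel)).false_of_space hN

end Lines

/-! ### Contraction of a line: the inseparable case, and long lines across a separation. -/

section LocalStructure

variable {α : Type*} {M N : Matroid α} {K L L₀ X Y Z A B : Set α} {a b c e f x y : α}

/-- If the contraction of a line is inseparable, then three of its points cannot all lie on
further long lines. -/
theorem IsLine.false_of_isInseparable [M.Finite] (hM : M.IsSimple) (hfig : M.NoFigureMinor)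
    (hL : M.IsLine L) (hi : (M ／ L).IsInseparable) (p : Fin 3 → α) (hp : Function.Injective p)
    (hpL : ∀ i, p i ∈ L) (K : Fin 3 → Set α) (hK : ∀ i, M.IsLongLine (K i))
    (hpK : ∀ i, p i ∈ K i) (hKL : ∀ i, K i ≠ L) : False := by
  -- The `z i` may coincide in part, but not all three: on a single point inseparability would not
  -- exclude a loop.
  obtain ⟨z, hzK, hzp, h01, h02⟩ : ∃ z : Fin 3 → α, (∀ i, z i ∈ K i) ∧ (∀ i, z i ≠ p i) ∧
      z 0 ≠ z 1 ∧ z 0 ≠ z 2 := by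
    obtain ⟨z0, h1, h2, -⟩ := exists_mem_ne_ne_of_three_le_ncard (hK 0).2 (p 0) (p 0)
    obtain ⟨z1, h3, h4, h5⟩ := exists_mem_ne_ne_of_three_le_ncard (hK 1).2 (p 1) z0
    obtain ⟨z2, h6, h7, h8⟩ := exists_mem_ne_ne_of_three_le_ncard (hK 2).2 (p 2) z0
    refine ⟨![z0, z1, z2], ?_, ?_, h5.symm, h8.symm⟩
    · simpa [Fin.forall_fin_succ] using ⟨h1, h3, h6⟩
    · simpa [Fin.forall_fin_succ] using ⟨h2, h4, h7⟩
  choose w hwK hwp hwz using fun i => exists_mem_ne_ne_of_three_le_ncard (hK i).2 (p i) (z i)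
  have hKE : ∀ i, K i ⊆ M.E := fun i => (hK i).1.subset_ground
  have hLE : L ⊆ M.E := hL.subset_ground
  have hKL' : ∀ i, ∀ x ∈ K i, x ≠ p i → x ∉ L := fun i x hx hne hxL =>
    hKL i ((hK i).1.eq_of_mem hL hM hx (hpK i) hxL (hpL i) hne)
  set Z : Set α := Set.range z with hZ
  have hZE : Z ⊆ (M ／ L).E := by
    rintro _ ⟨i, rfl⟩
    exact ⟨hKE i (hzK i), hKL' i _ (hzK i) (hzp i)⟩
  obtain ⟨C, hC, hCi, hCZ⟩ := hi.exists_indep_contract_restrict hZE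
  have hCE : C ⊆ M.E := fun x hx => (hC hx).1.1
  have hCf : C.Finite := M.ground_finite.subset hCE
  -- `C` is independent in `M ／ L`, so contracting it does not lower the rank of `L`.
  have hRL : (M ／ C).rk L = 2 := by
    have h1 := M.rk_contract_add L C
    have h2 := M.rk_contract_add C L
    have h3 := (indep_iff_rk hCf).1 hCi
    have h4 := M.rk_le_ncard hCf
    have h5 := rk_contract_le (M := M) C L
    rw [Set.union_comm] at h2
    rw [hL.2] at h1 h5
    omega
  set g : Set α → ℕ := fun X => (M ／ L ／ C).rk X with hg
  have hgR : ∀ X, g X + 2 = (M ／ C).rk (X ∪ L) := fun X => by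
    have := (M ／ C).rk_contract_add L X
    rw [hRL, contract_contract, Set.union_comm C L, ← contract_contract] at this
    exact this
  have hgZ : ∀ A ⊆ Z, A.Nonempty → (Z \ A).Nonempty → g Z < g A + g (Z \ A) := fun A hA h1 h2 => by
    have h3 := hCZ A hA h1 h2
    rwa [restrict_ground_eq, rk_restrict _ hA, rk_restrict _ Set.sdiff_subset,
      rk_restrict _ subset_rfl] at h3
  have hne : ∀ i, ∃ j, z j ≠ z i := fun i => by
    by_cases hi0 : i = 0
    · exact ⟨1, hi0 ▸ h01.symm⟩
    · by_cases h : z 0 = z i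
      · rcases (by omega : i = 1 ∨ i = 2) with rfl | rfl
        exacts [absurd h h01, absurd h h02]
      · exact ⟨0, h⟩
  have hgi : ∀ i, g Z < g {z i} + g (Z \ {z i}) := fun i => by
    obtain ⟨j, hj⟩ := hne i
    exact hgZ _ (Set.singleton_subset_iff.2 ⟨i, rfl⟩) (Set.singleton_nonempty _) ⟨z j, ⟨j, rfl⟩, hj⟩
  have hg1 : ∀ i, 1 ≤ g {z i} := fun i => by
    have h1 := hgi i
    have h2 : g (Z \ {z i}) ≤ g Z := rk_mono _ Set.sdiff_subset
    omega
  have hLp : ∀ i j, i ≠ j → L ⊆ M.closure {p i, p j} := fun i j hij =>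
    hL.subset_closure_pair hM (hpL i) (hpL j) (fun h => hij (hp h))
  have hLX : ∀ {X : Set α}, X ⊆ M.E → p 0 ∈ X → p 1 ∈ X → L ⊆ M.closure X := fun hX h0 h1 =>
    (hLp 0 1 (by decide)).trans (M.closure_subset_closure (Set.pair_subset h0 h1))
  have hLz : ∀ i, 3 ≤ (M ／ C).rk {p 0, p 1, z i} := fun i => by
    have h1 := hgR {z i}
    have h2 := hg1 i
    have hX : {p 0, p 1, z i} ⊆ M.E := by
      rintro x (rfl | rfl | rfl)
      exacts [hLE (hpL 0), hLE (hpL 1), hKE i (hzK i)]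
    have h3 : (M ／ C).rk ({z i} ∪ L) ≤ (M ／ C).rk {p 0, p 1, z i} := by
      refine rk_contract_le_of_subset_closure (Set.union_subset ?_ (hLX hX (by simp) (by simp)))
      exact Set.singleton_subset_iff.2 (M.mem_closure_of_mem (by simp) hX)
    omega
  -- The points `x, y` span `K i`, and one more point of `L` yields all of `L` and `z i`, a set of
  -- rank at least three in `M ／ C`. So `x, y` remain independent.
  have hpair : ∀ i, ∀ x ∈ K i, ∀ y ∈ K i, x ≠ y → 2 ≤ (M ／ C).rk {x, y} := fun i x hx y hy hxy => by
    have h1 := rk_contract_le_of_subset_closure (C := C)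
      ((hK i).1.subset_closure_pair hM hx hy hxy)
    obtain ⟨q, hq⟩ : ∃ j, j ≠ i := exists_ne i
    have h2 : (M ／ C).rk ({z i} ∪ L) ≤ (M ／ C).rk (insert (p q) (K i)) := by
      have hX : insert (p q) (K i) ⊆ M.E := Set.insert_subset (hLE (hpL q)) (hKE i)
      refine rk_contract_le_of_subset_closure (Set.union_subset ?_ ?_)
      · exact Set.singleton_subset_iff.2 (M.mem_closure_of_mem (Or.inr (hzK i)) hX)
      · exact (hLp q i hq).trans (M.closure_subset_closure
          (Set.pair_subset (Or.inl rfl) (Or.inr (hpK i))))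
    have h3 := (M ／ C).rk_insert_le (p q) (K i)
    have h4 := hgR {z i}
    have h5 := hg1 i
    omega
  have hCE' : ∀ x ∈ M.E, 1 ≤ (M ／ C).rk {x} → x ∈ (M ／ C).E := fun x hx h1 => by
    by_contra hx'
    rw [← rk_inter_ground, Set.singleton_inter_eq_empty.2 hx', rk_empty] at h1
    omega
  have hmem : ∀ i, ∀ x ∈ K i, x ∈ (M ／ C).E := fun i x hx => by
    obtain ⟨y, hy, hyx, -⟩ := exists_mem_ne_ne_of_three_le_ncard (hK i).2 x x
    refine hCE' x (hKE i hx) ?_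
    have h1 := hpair i y hy x hx hyx
    have h2 := (M ／ C).rk_insert_le y {x}
    omega
  have hsix : {p 0, p 1, p 2, z 0, z 1, z 2} ⊆ Z ∪ L := by
    rintro x (rfl | rfl | rfl | rfl | rfl | rfl)
    exacts [Or.inr (hpL 0), Or.inr (hpL 1), Or.inr (hpL 2), Or.inl ⟨0, rfl⟩, Or.inl ⟨1, rfl⟩,
      Or.inl ⟨2, rfl⟩]
  have hsix' := (M ／ C).rk_mono hsix
  refine false_of_columns (hfig.isMinor (M.contract_isMinor' C)) p z w
    (fun i => hmem i _ (hpK i)) (fun i => hmem i _ (hzK i)) (fun i => hmem i _ (hwK i)) ?_ ?_ ?_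
    (fun i => hpair i _ (hpK i) _ (hzK i) (hzp i).symm)
    (fun i => hpair i _ (hpK i) _ (hwK i) (hwp i).symm)
    (fun i => hpair i _ (hzK i) _ (hwK i) (hwz i).symm) hLz ?_
  · refine (rk_mono _ (?_ : _ ⊆ L)).trans hRL.le
    rintro x (rfl | rfl | rfl)
    exacts [hpL 0, hpL 1, hpL 2]
  · intro i
    refine (rk_contract_le _ _).trans ?_
    rw [← (hK i).1.2]
    refine rk_mono _ ?_
    rintro x (rfl | rfl | rfl)
    exacts [hpK i, hzK i, hwK i]
  · intro i j hij
    refine hRL.ge.trans ?_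
    exact rk_contract_le_of_subset_closure (hLp i j hij)
  · have h1 := hgR Z
    -- Inseparability on `Z` leaves two cases: rank at most one, where all three lines are coplanar
    -- with `L`, or rank two with every two of the `z i` independent, as separating off the third
    -- would otherwise be possible.
    by_cases hgZ1 : g Z ≤ 1
    · left
      omega
    · right
      have h2 : ∀ i j, i ≠ j → 2 ≤ g {z i, z j} ∧ g Z ≤ 2 := fun i j hij => by
        obtain ⟨k, hki, hkj⟩ : ∃ k : Fin 3, k ≠ i ∧ k ≠ j := by
          revert i j; decide
        have hsub : Z \ {z k} ⊆ {z i, z j} := by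
          rintro _ ⟨⟨q, rfl⟩, hq⟩
          have hqk : q ≠ k := fun h => hq (h ▸ rfl)
          rcases (by omega : q = i ∨ q = j) with rfl | rfl
          exacts [Or.inl rfl, Or.inr rfl]
        have h3 := hgi k
        have h4 : g {z k} ≤ 1 := rk_singleton_le _ _
        have h5 : g (Z \ {z k}) ≤ g {z i, z j} := rk_mono _ hsub
        have h6 : g {z i, z j} ≤ g {z j} + 1 := rk_insert_le _ _ _
        have h7 : g {z j} ≤ 1 := rk_singleton_le _ _
        omega
      refine ⟨by have := h2 0 1 (by decide); omega, fun i j hij => ?_⟩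
      have h3 := hgR {z i, z j}
      have h4 := h2 i j hij
      have hX : {p 0, p 1, z i, z j} ⊆ M.E := by
        rintro x (rfl | rfl | rfl | rfl)
        exacts [hLE (hpL 0), hLE (hpL 1), hKE i (hzK i), hKE j (hzK j)]
      have h5 : (M ／ C).rk ({z i, z j} ∪ L) ≤ (M ／ C).rk {p 0, p 1, z i, z j} := by
        refine rk_contract_le_of_subset_closure (Set.union_subset ?_ (hLX hX (by simp) (by simp)))
        exact Set.pair_subset (M.mem_closure_of_mem (by simp) hX)
          (M.mem_closure_of_mem (by simp) hX)
      omega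

/-- The points `a` and `c` span `K`, so in `M ／ L` the point `b` is spanned by points of `A`. As `b`
is not a loop there, this contradicts the separation. -/
lemma IsLongLine.false_of_separation [M.Finite] (hM : M.IsSimple) (hL : M.IsLine L)
    (hK : M.IsLongLine K) (hAB : A ∪ B = M.E \ L)
    (hsep : (M ／ L).rk A + (M ／ L).rk B ≤ (M ／ L).rk (A ∪ B))
    (haK : a ∈ K) (haA : a ∈ A) (hcK : c ∈ K) (hc : c ∈ A ∪ L) (hca : c ≠ a) (hb : b ∈ K)
    (hbB : b ∈ B) : False := by
  have h1 := rk_add_rk_le_of_separation hsep (X := (K \ L) ∩ A) (Y := {b})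
    Set.inter_subset_right (Set.singleton_subset_iff.2 hbB)
  have haL : a ∉ L := (hAB ▸ Or.inl haA : a ∈ M.E \ L).2
  have hbL : b ∉ L := (hAB ▸ Or.inr hbB : b ∈ M.E \ L).2
  have h2 : (M ／ L).rk ((K \ L) ∩ A ∪ {b}) ≤ (M ／ L).rk ((K \ L) ∩ A) := by
    have h3 := M.rk_contract_add L ((K \ L) ∩ A ∪ {b})
    have h4 := M.rk_contract_add L ((K \ L) ∩ A)
    have h5 : M.rk ((K \ L) ∩ A ∪ {b} ∪ L) ≤ M.rk ((K \ L) ∩ A ∪ L) := by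
      refine rk_le_of_subset_closure ?_
      have hE : (K \ L) ∩ A ∪ L ⊆ M.E := Set.union_subset
        (fun x hx => hK.1.subset_ground hx.1.1) hL.subset_ground
      have h6 : K ⊆ M.closure ((K \ L) ∩ A ∪ L) := by
        refine (hK.1.subset_closure_pair hM haK hcK hca.symm).trans
          (M.closure_subset_closure (Set.pair_subset (Or.inl ⟨⟨haK, haL⟩, haA⟩) ?_))
        by_cases hcL : c ∈ L
        · exact Or.inr hcL
        · exact Or.inl ⟨⟨hcK, hcL⟩, hc.resolve_right hcL⟩
      rintro x ((hx | rfl) | hx)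
      · exact h6 hx.1.1
      · exact h6 hb
      · exact M.mem_closure_of_mem (Or.inr hx) hE
    omega
  have h3 : 1 ≤ (M ／ L).rk {b} := by
    have h4 := M.rk_contract_add L {b}
    have h5 := (isFlat_iff_forall_rk hL.subset_ground).1 hL.1 b (hK.1.subset_ground hb) hbL
    rw [Set.singleton_union] at h4
    omega
  omega

/-- A long line lies, apart from its point on `L`, on one side of any separation of the
contraction of the line `L`. -/
lemma IsLongLine.sdiff_subset_of_separation [M.Finite] (hM : M.IsSimple) (hL : M.IsLine L)
    (hK : M.IsLongLine K) (hAB : A ∪ B = M.E \ L)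
    (hsep : (M ／ L).rk A + (M ／ L).rk B ≤ (M ／ L).rk (A ∪ B)) : K \ L ⊆ A ∨ K \ L ⊆ B := by
  by_contra! hno
  obtain ⟨b, hb, hbA⟩ := Set.not_subset.1 hno.1
  obtain ⟨a, ha, haB⟩ := Set.not_subset.1 hno.2
  have hmem : ∀ x ∈ K, x ∉ L → x ∈ A ∪ B := fun x hx hxL => hAB ▸ ⟨hK.1.subset_ground hx, hxL⟩
  have hbB := (hmem b hb.1 hb.2).resolve_left hbA
  have haA := (hmem a ha.1 ha.2).resolve_right haB
  -- The third point is what makes length matter: wherever it lies, with `a` or with `b` it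
  -- determines `K` from one side.
  obtain ⟨c, hcK, hca, hcb⟩ := exists_mem_ne_ne_of_three_le_ncard hK.2 a b
  by_cases hc : c ∈ A ∪ L
  · exact hK.false_of_separation hM hL hAB hsep ha.1 haA hcK hc hca hb.1 hbB
  · rw [Set.mem_union, not_or] at hc
    rw [Set.union_comm] at hAB hsep
    rw [add_comm] at hsep
    exact hK.false_of_separation hM hL hAB hsep hb.1 hbB hcK
      (Or.inl (by have := hmem c hcK hc.2; exact this.resolve_left hc.1)) hcb ha.1 haA

end LocalStructure

/-! ### Existence of a point on at most one long line, and its contraction. -/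

section FreePoints

variable {α : Type*} {M N : Matroid α} {K L L₀ X Y Z A B : Set α} {a b c e f t x y : α}

/-- `t` lies on at most one long line. -/
def OnAtMostOneLongLine (M : Matroid α) (t : α) : Prop :=
  ∀ K K', M.IsLongLine K → M.IsLongLine K' → t ∈ K → t ∈ K' → K = K'

/-- If every point off the long line `L₀` lies on two long lines, then there are no points
off `L₀`. -/
theorem IsLongLine.ground_subset [M.Finite] (hM : M.IsSimple) (hfig : M.NoFigureMinor)
    (hL₀ : M.IsLongLine L₀) (h : ∀ x ∈ M.E \ L₀, ¬ M.OnAtMostOneLongLine x) : M.E ⊆ L₀ := by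
  obtain ⟨n, hn⟩ : ∃ n, M.E.ncard = n := ⟨_, rfl⟩
  induction n using Nat.strong_induction_on generalizing M L₀ with
  | _ n ih =>
    by_contra hcon
    obtain ⟨x, hxE, hxL₀⟩ := Set.not_subset.1 hcon
    have h2 : ∀ x ∈ M.E \ L₀, ∃ K K', M.IsLongLine K ∧ M.IsLongLine K' ∧ x ∈ K ∧ x ∈ K' ∧
        K ≠ K' := fun x hx => by simpa [OnAtMostOneLongLine] using h x hx
    obtain ⟨L, -, hL, -, hxL, -, -⟩ := h2 x ⟨hxE, hxL₀⟩
    have hLL₀ : L₀ ≠ L := fun h => hxL₀ (h ▸ hxL)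
    have hcol : ∀ p ∈ L, ∃ K, M.IsLongLine K ∧ p ∈ K ∧ K ≠ L := fun p hp => by
      by_cases hpL₀ : p ∈ L₀
      · exact ⟨L₀, hL₀, hpL₀, hLL₀⟩
      · obtain ⟨K, K', hK, hK', hpK, hpK', hne⟩ := h2 p ⟨hL.1.subset_ground hp, hpL₀⟩
        by_cases hKL : K = L
        · exact ⟨K', hK', hpK', fun h => hne (hKL.trans h.symm)⟩
        · exact ⟨K, hK, hpK, hKL⟩
    -- If `L₀` lies on the side `A`, then the restriction to `L ∪ B`, with `L` in the role of `L₀`,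
    -- is a smaller counterexample: a point of `B` is off `L₀`, and both of its long lines stay
    -- within `L ∪ B`.
    have key : ∀ A B, A ∪ B = M.E \ L → Disjoint A B → A.Nonempty → B.Nonempty →
        (M ／ L).rk A + (M ／ L).rk B ≤ (M ／ L).rk (A ∪ B) → ¬ (L₀ \ L ⊆ A) := by
      intro A B hAB hdisj ⟨a, ha⟩ ⟨b, hb⟩ hsep hL₀A
      have hBE : B ⊆ M.E \ L := hAB ▸ Set.subset_union_right
      have hRE : L ∪ B ⊆ M.E := Set.union_subset hL.1.subset_ground (hBE.trans Set.sdiff_subset)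
      have : (M ↾ (L ∪ B)).Finite := restrict_finite (M.ground_finite.subset hRE)
      have haE : a ∈ M.E \ L := hAB ▸ Or.inl ha
      have hlt : (M ↾ (L ∪ B)).E.ncard < n := by
        rw [← hn, restrict_ground_eq]
        exact Set.ncard_lt_ncard ⟨hRE, fun h => (h haE.1).elim haE.2
          (Set.disjoint_left.1 hdisj ha)⟩ M.ground_finite
      refine (hBE hb).2 (ih _ hlt (hM.restrict hRE) (hfig.isMinor (M.restrict_isMinor hRE))
        (hL.restrict hRE Set.subset_union_left) ?_ rfl (Or.inr hb))
      rintro y ⟨hy, hyL⟩ hy1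
      have hyB : y ∈ B := hy.resolve_left hyL
      have hyA : y ∉ A := Set.disjoint_right.1 hdisj hyB
      obtain ⟨K, K', hK, hK', hyK, hyK', hne⟩ := h2 y ⟨hRE hy, fun h => hyA (hL₀A ⟨h, hyL⟩)⟩
      have hsub : ∀ K, M.IsLongLine K → y ∈ K → K ⊆ L ∪ B := fun K hK hyK => by
        rcases hK.sdiff_subset_of_separation hM hL.1 hAB hsep with h3 | h3
        · exact absurd (h3 ⟨hyK, hyL⟩) hyA
        · exact Set.sdiff_subset_iff.1 h3
      exact hne (hy1 K K' (hK.restrict hRE (hsub K hK hyK)) (hK'.restrict hRE (hsub K' hK' hyK'))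
        hyK hyK')
    by_cases hi : (M ／ L).IsInseparable
    · obtain ⟨a, haL, -, -⟩ := exists_mem_ne_ne_of_three_le_ncard hL.2 x x
      obtain ⟨b, hbL, hba, -⟩ := exists_mem_ne_ne_of_three_le_ncard hL.2 a a
      obtain ⟨c, hcL, hca, hcb⟩ := exists_mem_ne_ne_of_three_le_ncard hL.2 a b
      have hpL : ∀ i, ![a, b, c] i ∈ L := by
        simpa [Fin.forall_fin_succ] using ⟨haL, hbL, hcL⟩
      choose K hK hpK hKL using fun i => hcol _ (hpL i)
      refine hL.1.false_of_isInseparable hM hfig hi ![a, b, c] ?_ hpL K hK hpK hKL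
      intro i j hij
      fin_cases i <;> fin_cases j <;> simp_all
    · simp only [IsInseparable, not_forall, not_lt, contract_ground] at hi
      obtain ⟨A, hA, hAn, hBn, hsep⟩ := hi
      have hAB : A ∪ ((M.E \ L) \ A) = M.E \ L := Set.union_sdiff_cancel hA
      rw [← hAB, Set.union_sdiff_cancel hA] at hsep
      rcases hL₀.sdiff_subset_of_separation hM hL.1 hAB (by rwa [hAB]) with h3 | h3
      · exact key _ _ hAB Set.disjoint_sdiff_right hAn hBn (by rwa [hAB]) h3
      · exact key _ _ (by rwa [Set.union_comm]) Set.disjoint_sdiff_left hBn hAn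
          (by rwa [Set.union_comm, hAB, add_comm]) h3

/-- Otherwise `IsLongLine.ground_subset` applies to any long line, so each of two long lines through
one point would be contained in the other. -/
theorem exists_onAtMostOneLongLine [M.Finite] (hM : M.IsSimple) (hfig : M.NoFigureMinor)
    (hE : M.E.Nonempty) : ∃ t ∈ M.E, M.OnAtMostOneLongLine t := by
  by_contra! hcon
  obtain ⟨e, he⟩ := hE
  have h1 := hcon e he
  simp only [OnAtMostOneLongLine, not_forall] at h1
  obtain ⟨K, K', hK, hK', heK, heK', hne⟩ := h1
  have h2 := hK.ground_subset hM hfig fun x hx => hcon x hx.1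
  obtain ⟨f, hf, hfe, -⟩ := exists_mem_ne_ne_of_three_le_ncard hK'.2 e e
  exact hne (hK.1.eq_of_mem hK'.1 hM heK (h2 (hK'.1.subset_ground hf)) heK' hf hfe.symm)

/-- The line `K` contains all points that can become parallel to another point when `t` is
contracted. -/
lemma OnAtMostOneLongLine.exists_isLine [M.Finite] (ht : M.OnAtMostOneLongLine t)
    (hM : M.IsSimple) (htE : t ∈ M.E) (hr : 2 ≤ M.rk M.E) :
    ∃ K, M.IsLine K ∧ t ∈ K ∧ ∀ x ∈ M.E, ∀ y ∈ M.E, x ≠ t → y ≠ t → x ≠ y →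
      M.rk {t, x, y} ≤ 2 → x ∈ K ∧ y ∈ K := by
  have hlong : ∀ x ∈ M.E, ∀ y ∈ M.E, x ≠ t → y ≠ t → x ≠ y → M.rk {t, x, y} ≤ 2 →
      M.IsLongLine (M.closure {t, x}) ∧ {t, x, y} ⊆ M.closure {t, x} :=
    fun x hx y hy hxt hyt hxy h => by
      have h1 : {t, x, y} ⊆ M.closure {t, x} := subset_closure_of_rk_le
        (by rintro z (rfl | rfl | rfl) <;> assumption)
        (by rintro z (rfl | rfl) <;> simp) (by rwa [hM.rk_pair htE hx hxt.symm])
      refine ⟨⟨isLine_closure_pair hM htE hx hxt.symm, ?_⟩, h1⟩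
      have h2 : ({t, x, y} : Set α).ncard = 3 :=
        Set.ncard_eq_three.2 ⟨t, x, y, hxt.symm, hyt.symm, hxy, rfl⟩
      exact h2 ▸ Set.ncard_le_ncard h1 (M.ground_finite.subset (M.closure_subset_ground _))
  by_cases hK : ∃ K, M.IsLongLine K ∧ t ∈ K
  · obtain ⟨K, hK, htK⟩ := hK
    refine ⟨K, hK.1, htK, fun x hx y hy hxt hyt hxy h => ?_⟩
    obtain ⟨h1, h2⟩ := hlong x hx y hy hxt hyt hxy h
    rw [ht K _ hK h1 htK (h2 (by simp))]
    exact ⟨h2 (by simp), h2 (by simp)⟩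
  -- With no long line through `t` there are no such collinear triples, and any line through `t`
  -- serves.
  · obtain ⟨f, hfE, hft⟩ : ∃ f ∈ M.E, f ≠ t := by
      by_contra! hcon
      have h1 : M.rk M.E ≤ M.rk {t} := M.rk_mono hcon
      have h2 := M.rk_singleton_le t
      omega
    refine ⟨_, isLine_closure_pair hM htE hfE hft.symm,
      M.mem_closure_of_mem (by simp) (Set.pair_subset htE hfE),
      fun x hx y hy hxt hyt hxy h => ?_⟩
    obtain ⟨h1, h2⟩ := hlong x hx y hy hxt hyt hxy h
    exact absurd ⟨_, h1, h2 (by simp)⟩ hK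

/-- The simplification of the contraction of a point `t` all of whose lines other than `K`
have two points. -/
lemma contract_restrict_properties [M.Finite] (hM : M.IsSimple) (hK : M.IsLine K) (htK : t ∈ K)
    (hlines : ∀ x ∈ M.E, ∀ y ∈ M.E, x ≠ t → y ≠ t → x ≠ y → M.rk {t, x, y} ≤ 2 → x ∈ K ∧ y ∈ K)
    (hfK : f ∈ K) (hft : f ≠ t) :
    insert f (M.E \ K) ⊆ (M ／ {t}).E ∧ ((M ／ {t}) ↾ insert f (M.E \ K)).IsSimple ∧
      ((M ／ {t}) ↾ insert f (M.E \ K)).rk (insert f (M.E \ K)) + 1 = M.rk M.E ∧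
      (insert f (M.E \ K)).ncard + K.ncard = M.E.ncard + 1 := by
  have htE := hK.subset_ground htK
  have hfE := hK.subset_ground hfK
  have hsub : insert f (M.E \ K) ⊆ (M ／ {t}).E := by
    rintro x (rfl | hx)
    · exact ⟨hfE, hft⟩
    · exact ⟨hx.1, fun h => hx.2 (h ▸ htK)⟩
  have hrk : ∀ X, (M ／ {t}).rk X + 1 = M.rk (insert t X) := fun X => by
    have := M.rk_contract_add {t} X
    rwa [hM.rk_singleton htE, Set.union_singleton] at this
  refine ⟨hsub, fun x hx y hy => ?_, ?_, ?_⟩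
  · rw [restrict_ground_eq] at hx hy
    rw [restrict_indep_iff]
    refine ⟨?_, Set.pair_subset hx hy⟩
    rw [indep_iff_rk (Set.toFinite _)]
    have h1 := hrk {x, y}
    obtain ⟨hxE, hxt⟩ := hsub hx
    obtain ⟨hyE, hyt⟩ := hsub hy
    by_cases hxy : x = y
    · subst hxy
      rw [Set.pair_eq_singleton, hM.rk_pair htE hxE (Ne.symm hxt)] at h1
      rw [Set.pair_eq_singleton, Set.ncard_singleton]
      omega
    · have h2 : (M ／ {t}).rk {x, y} ≤ _ := rk_le_ncard _ (Set.toFinite _)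
      rw [Set.ncard_pair hxy] at h2 ⊢
      have h3 : ¬ M.rk {t, x, y} ≤ 2 := fun h => by
        obtain ⟨h3, h4⟩ := hlines x hxE y hyE hxt hyt hxy h
        rcases hx with rfl | hx
        · rcases hy with rfl | hy
          · exact hxy rfl
          · exact hy.2 h4
        · exact hx.2 h3
      omega
  · rw [rk_restrict _ subset_rfl, hrk]
    refine le_antisymm (M.rk_mono ?_) (rk_le_of_subset_closure fun x hx => ?_)
    · exact Set.insert_subset htE (hsub.trans (fun x hx => hx.1))
    · have hE : insert t (insert f (M.E \ K)) ⊆ M.E :=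
        Set.insert_subset htE (hsub.trans (fun x hx => hx.1))
      by_cases hxK : x ∈ K
      · exact M.closure_subset_closure (Set.pair_subset (by simp) (by simp))
          (hK.subset_closure_pair hM htK hfK hft.symm hxK)
      · exact M.mem_closure_of_mem (Or.inr (Or.inr ⟨hx, hxK⟩)) hE
  · rw [Set.ncard_insert_of_notMem (fun h => h.2 hfK) M.ground_finite.sdiff]
    have := Set.ncard_sdiff_add_ncard_of_subset hK.subset_ground M.ground_finite
    omega

end FreePoints

/-! ### Copies of `U_{2,n}` and the size of a line. -/

section Uniform

variable {α : Type*} {M N : Matroid α} {n : ℕ} {K X : Set α}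

lemma uniformTwo_ground (n : ℕ) : (uniformTwo n).E = Set.univ := rfl

lemma uniformTwo_indep_iff {I : Set (Fin n)} : (uniformTwo n).Indep I ↔ I.ncard ≤ 2 := by
  obtain ⟨J, rfl⟩ := I.toFinite.exists_finset_coe
  rw [Set.ncard_coe_finset]
  refine ⟨fun h => h J subset_rfl, fun h K hK => (Finset.card_le_card ?_).trans h⟩
  exact_mod_cast hK

/-- In a simple matroid of rank at most two, the independent sets are exactly those of size at most
two, so every bijection of ground sets is an isomorphism. -/
lemma isCopyOf_uniformTwo [M.Finite] (hM : M.IsSimple) (hr : M.rk M.E ≤ 2)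
    (hn : M.E.ncard = n) : M.IsCopyOf (uniformTwo n) := by
  have : Finite M.E := M.ground_finite
  let φ : Fin n ≃ M.E := (Finite.equivFinOfCardEq hn).symm
  have hinj : Function.Injective (fun i => (φ i : α)) :=
    Subtype.val_injective.comp φ.injective
  refine ⟨fun i => φ i, hinj.injOn, ext_indep ?_ fun I hI => ?_⟩
  · rw [map_ground, uniformTwo_ground, Set.image_univ]
    exact (Subtype.range_coe.symm.trans (φ.surjective.range_comp Subtype.val).symm)
  · have hrange : I = (fun i => (φ i : α)) '' ((fun i => (φ i : α)) ⁻¹' I) := by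
      rw [Set.image_preimage_eq_of_subset]
      intro x hx
      exact ⟨φ.symm ⟨x, hI hx⟩, by simp⟩
    have hIf := M.ground_finite.subset hI
    rw [hrange, map_image_indep_iff (Set.subset_univ _), ← hrange, uniformTwo_indep_iff,
      ← Set.ncard_image_of_injective _ hinj, ← hrange]
    constructor
    · intro h
      rw [indep_iff_rk hIf] at h
      exact h ▸ (M.rk_mono hI).trans hr
    · intro h
      rcases I.eq_empty_or_nonempty with rfl | ⟨x, hx⟩
      · exact M.empty_indep
      · obtain ⟨y, hy⟩ : ∃ y, I \ {x} ⊆ {y} := by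
          rw [← Set.ncard_sdiff_singleton_add_one hx hIf] at h
          rcases (Set.ncard_le_one_iff_eq (s := I \ {x}) hIf.sdiff).1 (by omega) with h0 | ⟨y, hy⟩
          · exact ⟨x, by rw [h0]; exact Set.empty_subset _⟩
          · exact ⟨y, hy.subset⟩
        by_cases hyE : y ∈ M.E
        · refine (hM x (hI hx) y hyE).subset fun z hz => ?_
          by_cases hzx : z = x
          · exact Or.inl hzx
          · exact Or.inr (hy ⟨hz, hzx⟩)
        · refine (hM x (hI hx) x (hI hx)).subset fun z hz => ?_
          by_cases hzx : z = x
          · exact Or.inl hzx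
          · exact absurd (hI hz) (fun h => hyE (hy ⟨hz, hzx⟩ ▸ h))

lemma IsCopyOf.uniformTwo_properties (h : M.IsCopyOf (uniformTwo n)) :
    M.Finite ∧ M.IsSimple ∧ M.E.ncard = n ∧ M.rk M.E ≤ 2 := by
  obtain ⟨f, hf, rfl⟩ := h
  have hinj : Function.Injective f := Set.injOn_univ.1 hf
  have hfin : ((uniformTwo n).map f hf).Finite := ⟨by
    rw [map_ground]; exact Set.toFinite _⟩
  refine ⟨hfin, ?_, ?_, ?_⟩
  · rintro _ ⟨i, -, rfl⟩ _ ⟨j, -, rfl⟩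
    rw [← Set.image_pair, map_image_indep_iff (Set.subset_univ _), uniformTwo_indep_iff]
    exact (Set.ncard_insert_le _ _).trans (by rw [Set.ncard_singleton])
  · rw [map_ground, Set.ncard_image_of_injective _ hinj, uniformTwo_ground, Set.ncard_univ,
      Nat.card_fin]
  · obtain ⟨B, hB⟩ := ((uniformTwo n).map f hf).exists_isBase
    have h1 := (hB.encard_eq_eRank).trans (eRank_eq_rk ((uniformTwo n).map f hf))
    obtain ⟨I, hI, h2⟩ := map_indep_iff.1 hB.indep
    rw [uniformTwo_indep_iff, ← Set.ncard_image_of_injective _ hinj, ← h2] at hI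
    rw [← Set.Finite.cast_ncard_eq (hfin.ground_finite.subset hB.subset_ground)] at h1
    exact (Nat.cast_injective h1) ▸ hI

lemma IsLine.ncard_le [M.Finite] (hM : M.IsSimple) (hK : M.IsLine K)
    (h : ¬ M.HasMinor (uniformTwo (n + 1))) : K.ncard ≤ n := by
  by_contra! hcon
  obtain ⟨X, hXK, hX⟩ := Set.exists_subset_card_eq (show n + 1 ≤ K.ncard from hcon)
  have hXE := hXK.trans hK.subset_ground
  have : (M ↾ X).Finite := restrict_finite (M.ground_finite.subset hXE)
  refine h ⟨M ↾ X, M.restrict_isMinor hXE, isCopyOf_uniformTwo (hM.restrict hXE) ?_ hX⟩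
  rw [restrict_ground_eq, rk_restrict _ subset_rfl, ← hK.2]
  exact M.rk_mono hXK

end Uniform

/-! ### The upper bound on the number of points. -/

section Bound

variable {α : Type*} {M N : Matroid α} {l r : ℕ} {K X : Set α} {f t : α}

lemma IsSimple.ncard_le_one [M.Finite] (hM : M.IsSimple) (hr : M.rk M.E ≤ 1) : M.E.ncard ≤ 1 := by
  rw [Set.ncard_le_one_iff M.ground_finite]
  intro a b ha hb
  by_contra hab
  have h1 := M.rk_mono (Set.pair_subset ha hb)
  rw [hM.rk_pair ha hb hab] at h1
  omega

/-- The finite simple matroids that have neither a figure minor nor a `U_{2,l+2}`-minor. -/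
structure IsBoundedSimple (l : ℕ) (M : Matroid α) : Prop where
  finite : M.Finite
  isSimple : M.IsSimple
  noFigureMinor : M.NoFigureMinor
  noLineMinor : ¬ M.HasMinor (uniformTwo (l + 2))

lemma IsBoundedSimple.isMinor (h : IsBoundedSimple l M) (hN : N ≤m M) (hs : N.IsSimple) :
    IsBoundedSimple l N :=
  ⟨hN.finite' h.finite, hs, h.noFigureMinor.isMinor hN, fun h' => h.noLineMinor (h'.trans_isMinor hN)⟩

lemma IsBoundedSimple.restrict (h : IsBoundedSimple l M) (hX : X ⊆ M.E) :
    IsBoundedSimple l (M ↾ X) :=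
  h.isMinor (M.restrict_isMinor hX) (h.isSimple.restrict hX)

/-- A line through a point on at most one long line, and the resulting simple minor. -/
lemma IsBoundedSimple.exists_isLine_minor (h : IsBoundedSimple l M) (ht : M.OnAtMostOneLongLine t)
    (htE : t ∈ M.E) (hr : M.rk M.E = r + 2) :
    ∃ K, M.IsLine K ∧ t ∈ K ∧ K.ncard ≤ l + 1 ∧
      (∀ x ∈ M.E, ∀ y ∈ M.E, x ≠ t → y ≠ t → x ≠ y → M.rk {t, x, y} ≤ 2 → x ∈ K ∧ y ∈ K) ∧
      ∃ f ∈ K, f ≠ t ∧ insert f (M.E \ K) ⊆ (M ／ {t}).E ∧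
        IsBoundedSimple l ((M ／ {t}) ↾ insert f (M.E \ K)) ∧
        ((M ／ {t}) ↾ insert f (M.E \ K)).rk (insert f (M.E \ K)) = r + 1 ∧
        (insert f (M.E \ K)).ncard + K.ncard = M.E.ncard + 1 := by
  have := h.finite
  have hM := h.isSimple
  obtain ⟨K, hK, htK, hlines⟩ := ht.exists_isLine hM htE (by omega)
  obtain ⟨f, hfK, hft⟩ : ∃ f ∈ K, f ≠ t := by
    by_contra! hcon
    have h1 : M.rk K ≤ M.rk {t} := M.rk_mono hcon
    have h2 := M.rk_singleton_le t
    rw [hK.2] at h1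
    omega
  obtain ⟨h1, h2, h3, h4⟩ := contract_restrict_properties hM hK htK hlines hfK hft
  refine ⟨K, hK, htK, hK.ncard_le hM h.noLineMinor, hlines, f, hfK, hft, h1, ?_, by omega, h4⟩
  exact h.isMinor ((restrict_isMinor _ h1).trans (M.contract_isMinor' {t})) h2

/-- Contracting a point on at most one long line and simplifying costs one rank and `K.ncard - 1 ≤
l` points. The rank is written `r + 1` so that no subtraction occurs. -/
theorem IsBoundedSimple.ncard_le (h : IsBoundedSimple l M) (hr : M.rk M.E = r + 1) :
    M.E.ncard ≤ l * r + 1 := by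
  induction r generalizing M with
  | zero =>
    have := h.finite
    simpa using h.isSimple.ncard_le_one (by omega)
  | succ r ih =>
    have := h.finite
    have hE : M.E.Nonempty := by
      rw [Set.nonempty_iff_ne_empty]
      intro h0
      rw [h0, rk_empty] at hr
      omega
    obtain ⟨t, htE, ht⟩ := exists_onAtMostOneLongLine h.isSimple h.noFigureMinor hE
    obtain ⟨K, -, -, hKl, -, f, -, -, -, hN, hNr, hcard⟩ := h.exists_isLine_minor ht htE hr
    have h1 := ih hN hNr
    rw [restrict_ground_eq] at h1
    rw [mul_add, mul_one]
    omega

end Bound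

/-! ### Parallel connections: rank, simplicity, leaves, and recognition. -/

section ParallelConnection

variable {α : Type*} {M N P : Matroid α} {l r : ℕ} {F H K X Y T : Set α} {e f t x y : α}

lemma IsFlat.inter_restrict (hF : M.IsFlat F) (hY : Y ⊆ M.E) : (M ↾ Y).IsFlat (F ∩ Y) := by
  rw [isFlat_iff_closure_eq, restrict_closure_eq _ Set.inter_subset_right hY]
  refine Set.Subset.antisymm ?_ (Set.subset_inter (M.subset_closure _
    (Set.inter_subset_right.trans hY)) Set.inter_subset_right)
  exact Set.inter_subset_inter_left _ ((M.closure_subset_closure Set.inter_subset_left).trans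
    hF.closure.subset)

lemma IsFlat.of_restrict (hF : (M ↾ H).IsFlat F) (hH : M.IsFlat H) : M.IsFlat F := by
  have hFH : F ⊆ H := hF.subset_ground
  have h1 := hF.closure
  rw [restrict_closure_eq _ hFH hH.subset_ground] at h1
  rw [isFlat_iff_closure_eq]
  rwa [Set.inter_eq_left.2 ((M.closure_subset_closure hFH).trans hH.closure.subset)] at h1

lemma IsSimple.isFlat_empty (hM : M.IsSimple) : M.IsFlat ∅ := by
  rw [isFlat_iff_closure_eq, Set.eq_empty_iff_forall_notMem]
  intro x hx
  have hxE := mem_ground_of_mem_closure hx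
  have h1 := hM x hxE x hxE
  rw [Set.pair_eq_singleton] at h1
  exact (indep_singleton.1 h1).not_isLoop hx

lemma IsSimple.isFlat_singleton [M.Finite] (hM : M.IsSimple) (hx : x ∈ M.E) : M.IsFlat {x} := by
  rw [isFlat_iff_forall_rk (Set.singleton_subset_iff.2 hx)]
  intro y hy hyx
  rw [hM.rk_singleton hx, hM.rk_pair hy hx hyx]

lemma IsParallelConnection.symm (h : IsParallelConnection P M N e) :
    IsParallelConnection P N M e :=
  ⟨by rw [Set.inter_comm, h.inter_eq], by rw [Set.union_comm, h.ground_eq], fun F => by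
    rw [h.isFlat_iff, Set.union_comm, and_comm (a := M.IsFlat _)]⟩

lemma IsParallelConnection.mem_left (h : IsParallelConnection P M N e) : e ∈ M.E :=
  (h.inter_eq ▸ rfl : e ∈ M.E ∩ N.E).1

lemma IsParallelConnection.mem_right (h : IsParallelConnection P M N e) : e ∈ N.E :=
  h.symm.mem_left

lemma IsParallelConnection.left_subset (h : IsParallelConnection P M N e) : M.E ⊆ P.E :=
  h.ground_eq ▸ Set.subset_union_left

lemma IsParallelConnection.eq_of_mem (h : IsParallelConnection P M N e) (hx : x ∈ M.E)
    (hx' : x ∈ N.E) : x = e :=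
  (h.inter_eq ▸ ⟨hx, hx'⟩ : x ∈ ({e} : Set α))

/-- The flat `M.closure X` extends to a flat of `P` with the same trace on `M.E`: adjoin all of
`N.E` if it contains the basepoint, and take it unchanged otherwise. The second case needs `N` to be
loopless. -/
lemma IsParallelConnection.closure_inter (h : IsParallelConnection P M N e) (hN : N.IsFlat ∅)
    (hX : X ⊆ M.E) : P.closure X ∩ M.E = M.closure X := by
  have hPE := h.left_subset
  have h1 := ((h.isFlat_iff _).1 (P.isFlat_closure X)).2.1
  refine Set.Subset.antisymm ?_ ?_
  · have hcl := M.closure_subset_ground X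
    rintro x ⟨hx, hxM⟩
    by_cases he : e ∈ M.closure X
    · have hflat : P.IsFlat (M.closure X ∪ N.E) := by
        rw [h.isFlat_iff]
        refine ⟨Set.union_subset_union_left _ hcl, ?_, ?_⟩
        · have : (M.closure X ∪ N.E) ∩ M.E = M.closure X := by
            ext y
            refine ⟨?_, fun hy => ⟨Or.inl hy, hcl hy⟩⟩
            rintro ⟨hy | hy, hyM⟩
            · exact hy
            · rwa [h.eq_of_mem hyM hy]
          rw [this]
          exact M.isFlat_closure X
        · rw [Set.inter_eq_right.2 Set.subset_union_right]
          exact N.ground_isFlat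
      have h2 : x ∈ M.closure X ∪ N.E := (P.closure_subset_closure
        ((M.subset_closure X).trans Set.subset_union_left)).trans hflat.closure.subset hx
      rcases h2 with h2 | h2
      · exact h2
      · rwa [h.eq_of_mem hxM h2]
    · have hflat : P.IsFlat (M.closure X) := by
        rw [h.isFlat_iff]
        refine ⟨hcl.trans Set.subset_union_left, ?_, ?_⟩
        · rw [Set.inter_eq_left.2 hcl]
          exact M.isFlat_closure X
        · have : M.closure X ∩ N.E = ∅ := by
            rw [Set.eq_empty_iff_forall_notMem]
            rintro y ⟨hy, hyN⟩
            exact he (h.eq_of_mem (hcl hy) hyN ▸ hy)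
          rwa [this]
      exact (P.closure_subset_closure (M.subset_closure X)).trans hflat.closure.subset hx
  · exact (M.closure_subset_closure (Set.subset_inter (P.subset_closure X (hX.trans hPE))
      hX)).trans h1.closure.subset

lemma IsParallelConnection.restrict_left (h : IsParallelConnection P M N e) (hN : N.IsFlat ∅) :
    P ↾ M.E = M := by
  refine ext_indep rfl fun I hI => ?_
  rw [restrict_ground_eq] at hI
  rw [restrict_indep_iff, and_iff_left hI,
    indep_iff_forall_notMem_closure_sdiff (hI.trans h.left_subset),
    indep_iff_forall_notMem_closure_sdiff hI]
  refine forall₂_congr fun x hx => ?_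
  rw [← h.closure_inter hN (Set.sdiff_subset.trans hI)]
  exact not_congr ⟨fun h => ⟨h, hI hx⟩, fun h => h.1⟩

lemma IsParallelConnection.rk_left (h : IsParallelConnection P M N e) (hN : N.IsFlat ∅)
    (hX : X ⊆ M.E) : P.rk X = M.rk X := by
  rw [← rk_restrict P hX, h.restrict_left hN]

lemma IsParallelConnection.isSimple [M.Finite] [N.Finite] (h : IsParallelConnection P M N e)
    (hM : M.IsSimple) (hN : N.IsSimple) : P.IsSimple := by
  have h1 : ∀ x ∈ M.E, ∀ y ∈ M.E, P.Indep {x, y} := fun x hx y hy => by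
    have := hM x hx y hy
    rw [← h.restrict_left hN.isFlat_empty, restrict_indep_iff] at this
    exact this.1
  have h2 : ∀ x ∈ N.E, ∀ y ∈ N.E, P.Indep {x, y} := fun x hx y hy => by
    have := hN x hx y hy
    rw [← h.symm.restrict_left hM.isFlat_empty, restrict_indep_iff] at this
    exact this.1
  have h3 : ∀ x ∈ M.E, ∀ y ∈ N.E, P.Indep {x, y} := fun x hx y hy => by
    by_cases hyM : y ∈ M.E
    · exact h1 x hx y hyM
    by_cases hxN : x ∈ N.E
    · exact h2 x hxN y hy
    have hflat : P.IsFlat {x} := by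
      rw [h.isFlat_iff]
      refine ⟨Set.singleton_subset_iff.2 (Or.inl hx), ?_, ?_⟩
      · rw [Set.inter_eq_left.2 (Set.singleton_subset_iff.2 hx)]
        exact hM.isFlat_singleton hx
      · rw [Set.singleton_inter_eq_empty.2 hxN]
        exact hN.isFlat_empty
    have hxI : P.Indep {x} := by
      have := h1 x hx x hx
      rwa [Set.pair_eq_singleton] at this
    rw [Set.pair_comm, hxI.insert_indep_iff, hflat.closure]
    exact Or.inl ⟨h.symm.left_subset hy, fun h => hyM (h ▸ hx)⟩
  intro x hx y hy
  rw [h.ground_eq] at hx hy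
  rcases hx with hx | hx <;> rcases hy with hy | hy
  · exact h1 x hx y hy
  · exact h3 x hx y hy
  · rw [Set.pair_comm]
    exact h3 y hy x hx
  · exact h2 x hx y hy

lemma IsParallelConnection.finite [M.Finite] [N.Finite] (h : IsParallelConnection P M N e) :
    P.Finite :=
  ⟨by rw [h.ground_eq]; exact M.ground_finite.union N.ground_finite⟩

/-- `M.E` is a flat of `P`, so a point of `N` other than the basepoint raises the rank;
submodularity over the common basepoint shows that the rest of `N` adds no more. -/
lemma IsParallelConnection.rk_ground [M.Finite] [N.Finite] [P.Finite]
    (h : IsParallelConnection P M N e)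
    (hM : M.IsSimple) (hN : N.IsSimple) (hr : N.rk N.E ≤ 2) (hn : 2 ≤ N.E.ncard) :
    P.rk P.E = M.rk M.E + 1 := by
  obtain ⟨y, hyN, hye⟩ := Set.exists_ne_of_one_lt_ncard hn e
  have hyM : y ∉ M.E := fun hy => hye (h.eq_of_mem hy hyN)
  have hflat : P.IsFlat M.E := by
    rw [h.isFlat_iff]
    refine ⟨Set.subset_union_left, by rw [Set.inter_self]; exact M.ground_isFlat, ?_⟩
    rw [h.inter_eq]
    exact hN.isFlat_singleton h.mem_right
  have h1 := (isFlat_iff_forall_rk h.left_subset).1 hflat y (h.symm.left_subset hyN) hyM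
  have h2 := h.rk_left hN.isFlat_empty (subset_refl M.E)
  have h3 := P.rk_mono (Set.insert_subset (h.symm.left_subset hyN) h.left_subset)
  have h4 := P.rk_submod M.E N.E
  rw [← h.ground_eq, h.inter_eq, h.symm.rk_left hM.isFlat_empty subset_rfl,
    (h.isSimple hM hN).rk_singleton (h.left_subset h.mem_left)] at h4
  omega

/-- The basic properties of parallel connections of copies of `U_{2,l+1}`. -/
theorem IsLineParallelConnection.properties (hl : 1 ≤ l) (h : IsLineParallelConnection l M) :
    M.Finite ∧ M.IsSimple ∧ ∃ r, M.rk M.E = r + 1 ∧ M.E.ncard = l * r + 1 := by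
  induction h with
  | point M e hE hI =>
    have hfin : M.Finite := ⟨by rw [hE]; exact Set.finite_singleton e⟩
    refine ⟨hfin, fun x hx y hy => ?_, 0, ?_, ?_⟩
    · rw [hE] at hx hy
      rw [hx, hy, Set.pair_eq_singleton]
      exact hI
    · rw [indep_iff_rk (Set.finite_singleton e), Set.ncard_singleton] at hI
      rw [hE, hI]
    · rw [hE, Set.ncard_singleton, mul_zero]
  | line M hM =>
    obtain ⟨h1, h2, h3, h4⟩ := hM.uniformTwo_properties
    refine ⟨h1, h2, 1, le_antisymm h4 ?_, by omega⟩
    obtain ⟨a, b, ha, hb, hab⟩ := (Set.one_lt_ncard_iff M.ground_finite).1 (by omega : 1 < M.E.ncard)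
    exact (h2.rk_pair ha hb hab).ge.trans (M.rk_mono (Set.pair_subset ha hb))
  | connect P M N e hM hN hP ih =>
    obtain ⟨h1, h2, r, h3, h4⟩ := ih
    obtain ⟨h5, h6, h7, h8⟩ := hN.uniformTwo_properties
    have hfin := hP.finite
    refine ⟨hfin, hP.isSimple h2 h6, r + 1, ?_, ?_⟩
    · rw [hP.rk_ground h2 h6 h8 (by omega), h3]
    · have h9 := Set.ncard_union_add_ncard_inter M.E N.E M.ground_finite N.ground_finite
      rw [← hP.ground_eq, hP.inter_eq, Set.ncard_singleton] at h9
      rw [mul_add, mul_one]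
      omega

/-- A parallel connection of copies of `U_{2,l+1}` has a copy attached at a single point `s`
and avoiding a given element, except possibly at `s`. -/
theorem IsLineParallelConnection.exists_leaf (hl : 1 ≤ l) (h : IsLineParallelConnection l M)
    (hr : 2 ≤ M.rk M.E) (hf : f ∈ M.E) :
    ∃ T s, T ⊆ M.E ∧ f ∉ T ∧ s ∈ M.E ∧ s ∉ T ∧ T.ncard = l ∧ M.rk (insert s T) ≤ 2 ∧
      M.rk (M.E \ T) + 1 ≤ M.rk M.E := by
  induction h generalizing f with
  | point M e hE hI =>
    have hfin : M.Finite := ⟨by rw [hE]; exact Set.finite_singleton e⟩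
    have := M.rk_singleton_le e
    rw [hE] at hr
    omega
  | line M hM =>
    obtain ⟨h1, h2, h3, h4⟩ := hM.uniformTwo_properties
    refine ⟨M.E \ {f}, f, Set.sdiff_subset, fun h => h.2 rfl, hf, fun h => h.2 rfl, ?_, ?_, ?_⟩
    · have := Set.ncard_sdiff_singleton_add_one hf M.ground_finite
      omega
    · rwa [Set.insert_sdiff_singleton, Set.insert_eq_of_mem hf]
    · rw [Set.sdiff_sdiff_cancel_left (Set.singleton_subset_iff.2 hf)]
      have := M.rk_singleton_le f
      omega
  | connect P M N e hM hN hP ih =>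
    obtain ⟨h1, h2, r, h3, h4⟩ := hM.properties hl
    obtain ⟨h5, h6, h7, h8⟩ := hN.uniformTwo_properties
    have hfin := hP.finite
    have hPs := hP.isSimple h2 h6
    have hPr := hP.rk_ground h2 h6 h8 (by omega)
    have hNE := hP.symm.left_subset
    have hPN := hP.symm.rk_left h2.isFlat_empty (subset_refl N.E)
    -- If `f ∈ M.E`, the last copy `N` is the leaf, attached at `e`.
    by_cases hfM : f ∈ M.E
    · refine ⟨N.E \ {e}, e, Set.sdiff_subset.trans hNE, fun h => h.2 (hP.eq_of_mem hfM h.1),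
        hP.left_subset hP.mem_left, fun h => h.2 rfl, ?_, ?_, ?_⟩
      · have := Set.ncard_sdiff_singleton_add_one hP.mem_right N.ground_finite
        omega
      · rw [Set.insert_sdiff_singleton, Set.insert_eq_of_mem hP.mem_right]
        omega
      · have h9 : P.rk (P.E \ (N.E \ {e})) ≤ P.rk M.E := P.rk_mono fun x hx => by
          have hx1 := hx.1
          rw [hP.ground_eq] at hx1
          refine hx1.elim id fun hxN => ?_
          have : x = e := by_contra fun h => hx.2 ⟨hxN, h⟩
          exact this ▸ hP.mem_left
        rw [hP.rk_left h6.isFlat_empty subset_rfl] at h9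
        omega
    · have hfN : f ∈ N.E := by
        rw [hP.ground_eq] at hf
        exact hf.resolve_left hfM
      by_cases hMr : 2 ≤ M.rk M.E
      -- A leaf of `M` chosen to avoid the basepoint `e` remains a leaf after attaching `N`, and it
      -- misses `f`.
      · obtain ⟨T, s, hT, heT, hs, hsT, hTl, hsr, hTr⟩ := ih hMr hP.mem_left
        refine ⟨T, s, hT.trans hP.left_subset, fun h => hfM (hT h), hP.left_subset hs, hsT, hTl,
          ?_, ?_⟩
        · rwa [hP.rk_left h6.isFlat_empty (Set.insert_subset hs hT)]
        · have h9 : P.rk (P.E \ T) ≤ P.rk ((M.E \ T) ∪ N.E) := P.rk_mono fun x hx => by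
            have hx1 := hx.1
            rw [hP.ground_eq] at hx1
            exact hx1.imp (fun h => ⟨h, hx.2⟩) id
          have h10 := P.rk_submod (M.E \ T) N.E
          have h11 : P.rk {e} ≤ P.rk ((M.E \ T) ∩ N.E) := P.rk_mono
            (Set.singleton_subset_iff.2 ⟨⟨hP.mem_left, heT⟩, hP.mem_right⟩)
          rw [hPs.rk_singleton (hP.left_subset hP.mem_left)] at h11
          rw [hP.rk_left h6.isFlat_empty Set.sdiff_subset] at h10
          omega
      -- Here `M` is a single point, so `P` lives on the one line `N`.
      · have hMe : M.E ⊆ N.E := fun x hx => by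
          have h9 := h2.ncard_le_one (by omega)
          rw [Set.ncard_le_one_iff M.ground_finite] at h9
          rw [h9 hx hP.mem_left]
          exact hP.mem_right
        have hPE : P.E = N.E := by rw [hP.ground_eq, Set.union_eq_right.2 hMe]
        refine ⟨N.E \ {f}, f, Set.sdiff_subset.trans hNE, fun h => h.2 rfl, hf, fun h => h.2 rfl,
          ?_, ?_, ?_⟩
        · have := Set.ncard_sdiff_singleton_add_one hfN N.ground_finite
          omega
        · rw [Set.insert_sdiff_singleton, Set.insert_eq_of_mem hfN]
          omega
        · rw [hPE, Set.sdiff_sdiff_cancel_left (Set.singleton_subset_iff.2 hfN)]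
          have := P.rk_singleton_le f
          rw [hPE] at hr
          omega

/-- A matroid covered by a flat and a line sharing a point is their parallel connection. -/
theorem isParallelConnection_restrict [M.Finite] (hM : M.IsSimple) (hH : M.IsFlat H)
    (hK : M.IsLine K) (hHK : H ∩ K = {x}) (hE : M.E = H ∪ K) :
    IsParallelConnection M (M ↾ H) (M ↾ K) x := by
  have hHE := hH.subset_ground
  have hKE := hK.subset_ground
  have hx : x ∈ H ∩ K := hHK ▸ rfl
  refine ⟨hHK, hE, fun F => ⟨fun hF => ⟨hE ▸ hF.subset_ground, hF.inter_restrict hHE,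
    hF.inter_restrict hKE⟩, ?_⟩⟩
  rintro ⟨hFE, hFH, hFK⟩
  simp only [restrict_ground_eq] at hFE hFH hFK
  replace hFH := hFH.of_restrict hH
  replace hFK := hFK.of_restrict hK.1
  have hFE' : F ⊆ M.E := hE ▸ hFE
  by_cases hFsub : F ⊆ H
  · rwa [Set.inter_eq_left.2 hFsub] at hFH
  obtain ⟨t, htF, htH⟩ := Set.not_subset.1 hFsub
  have htK : t ∈ K := (hFE htF).resolve_left htH
  have hflat : ∀ X, X ⊆ H → M.rk X + 1 ≤ M.rk (insert t X) := fun X hX => by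
    refine (rk_insert_of_notMem_closure (hKE htK) fun h => htH ?_).ge
    exact (M.closure_subset_closure hX).trans hH.closure.subset h
  have hpair : ∀ a ∈ K, ∀ b ∈ K, a ≠ b → ∀ X, a ∈ X → b ∈ X → X ⊆ M.E → K ⊆ M.closure X :=
    fun a ha b hb hab X haX hbX _ => (hK.subset_closure_pair hM ha hb hab).trans
      (M.closure_subset_closure (Set.pair_subset haX hbX))
  have hxK : ∀ y ∈ M.E, y ∉ H → y ∈ K := fun y hy hyH => (hE ▸ hy : y ∈ H ∪ K).resolve_left hyH
  have hKF : ∀ y ∈ F, y ∈ K → y ≠ t → K ⊆ F := fun y hyF hyK hyt => by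
    have h1 := hpair y hyK t htK hyt (F ∩ K) ⟨hyF, hyK⟩ ⟨htF, htK⟩
      (Set.inter_subset_right.trans hKE)
    rw [hFK.closure] at h1
    exact h1.trans Set.inter_subset_left
  -- The trace of `F` on `K` is either `{t}` or all of `K`; in the latter case `F ∩ H` contains the
  -- common point `x`. Either way `K` adds at most one to the rank.
  have hFr : M.rk F ≤ M.rk (F ∩ H) + 1 := by
    by_cases hKF' : K ⊆ F
    · have h1 := M.rk_submod (F ∩ H) K
      have h2 : M.rk F ≤ M.rk (F ∩ H ∪ K) := M.rk_mono fun y hy => by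
        by_cases hyH : y ∈ H
        · exact Or.inl ⟨hy, hyH⟩
        · exact Or.inr (hxK y (hFE' hy) hyH)
      have h3 : M.rk {x} ≤ M.rk (F ∩ H ∩ K) := M.rk_mono
        (Set.singleton_subset_iff.2 ⟨⟨hKF' hx.2, hx.1⟩, hx.2⟩)
      rw [hM.rk_singleton (hHE hx.1)] at h3
      rw [hK.2] at h1
      omega
    · refine (M.rk_mono fun y hy => ?_).trans (M.rk_insert_le t (F ∩ H))
      by_cases hyH : y ∈ H
      · exact Or.inr ⟨hy, hyH⟩
      · by_contra hcon
        exact hKF' (hKF y hy (hxK y (hFE' hy) hyH) fun h => hcon (Or.inl h))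
  have hstep : ∀ y ∈ H, y ∉ F → M.rk F + 1 ≤ M.rk (insert y F) := fun y hyH hyF => by
    have h1 := (isFlat_iff_forall_rk hFH.subset_ground).1 hFH y (hHE hyH) (fun h => hyF h.1)
    have h2 := hflat (insert y (F ∩ H)) (Set.insert_subset hyH Set.inter_subset_right)
    have h3 : M.rk (insert t (insert y (F ∩ H))) ≤ M.rk (insert y F) := M.rk_mono
      (Set.insert_subset (Or.inr htF) (Set.insert_subset_insert Set.inter_subset_left))
    omega
  rw [isFlat_iff_forall_rk hFE']
  intro y hyE hyF
  refine le_antisymm (M.rk_insert_le y F) ?_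
  by_cases hyH : y ∈ H
  · exact hstep y hyH hyF
  · have hyK := hxK y hyE hyH
    have hyt : y ≠ t := fun h => hyF (h ▸ htF)
    -- Adding `y` to `F` spans `K`, hence `x`, a point of `H` outside `F`, for which the rank
    -- increase is already known.
    have hxF : x ∉ F := fun hxF => hyF (hKF x hxF hx.2 (fun h => htH (h ▸ hx.1)) hyK)
    refine (hstep x hx.1 hxF).trans (rk_le_of_subset_closure ?_)
    have hyFE : insert y F ⊆ M.E := Set.insert_subset hyE hFE'
    refine Set.insert_subset (hpair y hyK t htK hyt _ (Or.inl rfl) (Or.inr htF) hyFE hx.2) ?_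
    exact (Set.subset_insert y F).trans (M.subset_closure _)

end ParallelConnection

/-! ### The case of equality: splitting off a line. -/

section Extremal

variable {α : Type*} {M N : Matroid α} {l r m : ℕ} {H K L T W X : Set α} {e f s t x y : α}

lemma OnAtMostOneLongLine.of_restrict (ht : (M ↾ X).OnAtMostOneLongLine t) (hX : X ⊆ M.E)
    (h : ∀ K, M.IsLongLine K → t ∈ K → K ⊆ X) : M.OnAtMostOneLongLine t :=
  fun K K' hK hK' htK htK' => ht K K' (hK.restrict hX (h K hK htK)) (hK'.restrict hX (h K' hK' htK'))
    htK htK'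

/-- If `s` is on a long line, `IsLongLine.ground_subset` is applied to that line. Otherwise deleting
`s` destroys no long line, and any suitable point of the deletion works. -/
lemma exists_ne_onAtMostOneLongLine [M.Finite] (hM : M.IsSimple) (hfig : M.NoFigureMinor)
    (h : ∃ t ∈ M.E, t ≠ s) : ∃ t ∈ M.E, t ≠ s ∧ M.OnAtMostOneLongLine t := by
  obtain ⟨t, htE, hts⟩ := h
  by_cases hs : ∃ K, M.IsLongLine K ∧ s ∈ K
  · obtain ⟨L, hL, hsL⟩ := hs
    by_contra! hcon
    have h1 := hL.ground_subset hM hfig fun x hx => hcon x hx.1 fun h => hx.2 (h ▸ hsL)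
    have h2 : ∀ K, M.IsLongLine K → K = L := fun K hK => by
      obtain ⟨a, ha, -, -⟩ := exists_mem_ne_ne_of_three_le_ncard hK.2 t t
      obtain ⟨b, hb, hba, -⟩ := exists_mem_ne_ne_of_three_le_ncard hK.2 a a
      exact hK.1.eq_of_mem hL.1 hM ha hb (h1 (hK.1.subset_ground ha))
        (h1 (hK.1.subset_ground hb)) hba.symm
    exact hcon t htE hts fun K K' hK hK' _ _ => (h2 K hK).trans (h2 K' hK').symm
  · have hX : M.E \ {s} ⊆ M.E := Set.sdiff_subset
    have : (M ↾ (M.E \ {s})).Finite := restrict_finite (M.ground_finite.subset hX)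
    obtain ⟨u, hu, hu1⟩ := exists_onAtMostOneLongLine (hM.restrict hX)
      (hfig.isMinor (M.restrict_isMinor hX)) ⟨t, htE, hts⟩
    exact ⟨u, hu.1, hu.2, hu1.of_restrict hX fun K hK _ z hz =>
      ⟨hK.1.subset_ground hz, fun h => hs ⟨K, hK, h ▸ hz⟩⟩⟩

/-- A leaf `T` of the simplified contraction of `e` is lifted to `M`: with one further point it is a
line `K` of `M`, and `H` is the complement of `T`. The hypothesis `ih` is the classification in the
previous rank. -/
lemma IsBoundedSimple.exists_flat_line (hl : 1 ≤ l) (h : IsBoundedSimple l M)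
    (hr : M.rk M.E = m + 3) (hcard : M.E.ncard = l * (m + 2) + 1)
    (ih : ∀ N : Matroid α, IsBoundedSimple l N → N.rk N.E = m + 2 →
      N.E.ncard = l * (m + 1) + 1 → IsLineParallelConnection l N) :
    ∃ H K x, M.IsFlat H ∧ M.IsLine K ∧ H ∩ K = {x} ∧ M.E = H ∪ K ∧ K.ncard = l + 1 ∧
      M.rk H = m + 2 ∧ H.ncard = l * (m + 1) + 1 := by
  have hfin := h.finite
  have hM := h.isSimple
  have hmul : l * (m + 2) = l * (m + 1) + l := by ring
  have hE : M.E.Nonempty := by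
    rw [← Set.ncard_pos M.ground_finite]
    omega
  obtain ⟨e, heE, he⟩ := exists_onAtMostOneLongLine hM h.noFigureMinor hE
  obtain ⟨L, hL, heL, hLl, hlines, f, hfL, hfe, hWe, hN, hNr, hWc⟩ :=
    h.exists_isLine_minor he heE hr
  set W := insert f (M.E \ L) with hW
  set N := (M ／ {e}) ↾ W with hNdef
  have hNfin := hN.finite
  have hNc := hN.ncard_le hNr
  have hNE : N.E = W := rfl
  rw [hNE] at hNc
  have hLc : L.ncard = l + 1 := by omega
  have hNL := ih N hN hNr (by rw [hNE]; omega)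
  -- The leaf must avoid `f`, which represents all of `L` except `e`, so that `T` is disjoint from
  -- `L`.
  obtain ⟨T, s, hTW, hfT, hsW, hsT, hTl, hsr, hTr⟩ := hNL.exists_leaf hl (by rw [hNE]; omega)
    (f := f) (Or.inl rfl)
  rw [hNE] at hTW hsW hTr
  have hWE : W ⊆ M.E := fun x hx => (hWe hx).1
  have hrk : ∀ X ⊆ W, N.rk X + 1 = M.rk (insert e X) := fun X hX => by
    have := M.rk_contract_add {e} X
    rwa [hM.rk_singleton heE, Set.union_singleton, ← rk_restrict _ hX] at this
  have hTE : T ⊆ M.E := hTW.trans hWE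
  have hTL : ∀ t ∈ T, t ∉ L := fun t ht => ((hTW ht).resolve_left fun h => hfT (h ▸ ht)).2
  have hTn : T.Nonempty := by
    rw [← Set.ncard_pos (M.ground_finite.subset hTE)]
    omega
  have hLcl : L ⊆ M.closure {e, f} := hL.subset_closure_pair hM heL hfL hfe.symm
  have hHr : M.rk (M.E \ T) ≤ m + 2 := by
    have h1 := hrk (W \ T) Set.sdiff_subset
    refine le_trans (rk_le_of_subset_closure (X := insert e (W \ T)) fun x hx => ?_) (by omega)
    have hXE : insert e (W \ T) ⊆ M.E := Set.insert_subset heE (Set.sdiff_subset.trans hWE)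
    by_cases hxL : x ∈ L
    · exact M.closure_subset_closure (Set.pair_subset (Or.inl rfl) (Or.inr ⟨Or.inl rfl, hfT⟩))
        (hLcl hxL)
    · exact M.mem_closure_of_mem (Or.inr ⟨Or.inr ⟨hx.1, hxL⟩, hx.2⟩) hXE
  have hNp : ∀ {a b}, a ∈ W → b ∈ W → a ≠ b → N.rk {a, b} = 2 := fun ha hb hab =>
    hN.isSimple.rk_pair ha hb hab
  -- In `N`, the points `s` and `t` span the leaf line, so `W \ T` and `t` together span `N`.
  have hHt : ∀ t ∈ T, m + 3 ≤ M.rk (insert t (M.E \ T)) := fun t ht => by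
    have h1 := N.rk_submod (insert t (W \ T)) (insert s T)
    have h2 : N.rk W ≤ N.rk (insert t (W \ T) ∪ insert s T) := N.rk_mono fun x hx => by
      by_cases hxT : x ∈ T
      · exact Or.inr (Or.inr hxT)
      · exact Or.inl (Or.inr ⟨hx, hxT⟩)
    have h3 : N.rk {s, t} ≤ N.rk (insert t (W \ T) ∩ insert s T) := N.rk_mono
      (Set.pair_subset ⟨Or.inr ⟨hsW, hsT⟩, Or.inl rfl⟩ ⟨Or.inl rfl, Or.inr ht⟩)
    rw [hNp hsW (hTW ht) (fun h => hsT (h ▸ ht))] at h3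
    have h4 := hrk (insert t (W \ T)) (Set.insert_subset (hTW ht) Set.sdiff_subset)
    have h5 : M.rk (insert e (insert t (W \ T))) ≤ M.rk (insert t (M.E \ T)) := M.rk_mono
      (Set.insert_subset (Or.inr ⟨heE, fun h => hTL e h heL⟩)
        (Set.insert_subset_insert (Set.sdiff_subset_sdiff_left hWE)))
    omega
  have hHr' : M.rk (M.E \ T) = m + 2 := by
    obtain ⟨t, ht⟩ := hTn
    have h1 := hHt t ht
    have h2 := M.rk_insert_le t (M.E \ T)
    omega
  have hH : M.IsFlat (M.E \ T) := by
    rw [isFlat_iff_forall_rk Set.sdiff_subset]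
    intro t htE ht
    have htT : t ∈ T := by_contra fun h => ht ⟨htE, h⟩
    have h1 := hHt t htT
    have h2 := M.rk_insert_le t (M.E \ T)
    omega
  have hKH : ∀ K, M.IsLine K → ∀ t ∈ T, t ∈ K → ∀ x ∈ K, ∀ y ∈ K, x ∉ T → y ∉ T → x = y :=
    fun K hK t ht htK x hx y hy hxT hyT => by
      by_contra hxy
      have h1 := (hK.subset_closure_pair hM hx hy hxy).trans (M.closure_subset_closure
        (Set.pair_subset (s := M.E \ T) ⟨hK.subset_ground hx, hxT⟩ ⟨hK.subset_ground hy, hyT⟩))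
      rw [hH.closure] at h1
      exact (h1 htK).2 ht
  -- A long line `K` meeting `T` has two points in `T`, since it meets the flat `M.E \ T` at most
  -- once. In `N` it therefore spans the leaf line, whose only point outside `T` is `s`. So a point
  -- of `K` outside `T` is `s` itself, or lies on `L` and is represented by `f = s`.
  have hlong : ∀ K, M.IsLongLine K → ∀ t ∈ T, t ∈ K → ∀ x ∈ K, x ∉ T →
      (x ∉ L ∧ x = s) ∨ (x ∈ L ∧ f = s) := fun K hK t ht htK x hx hxT => by
    obtain ⟨y, hy, hyx, hyt⟩ := exists_mem_ne_ne_of_three_le_ncard hK.2 x t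
    have hyT : y ∈ T := by
      by_contra hyT
      exact hyx (hKH K hK.1 t ht htK y hy x hx hyT hxT)
    have key : ∀ z ∈ W, z ∉ T → z ∈ M.closure (insert e K) → z = s := fun z hz hzT hzK => by
      by_contra hzs
      have h1 := hrk {z, t, y} (Set.insert_subset hz (Set.pair_subset (hTW ht) (hTW hyT)))
      have hKE : insert e K ⊆ M.E := Set.insert_subset heE hK.1.subset_ground
      have h2 : M.rk (insert e {z, t, y}) ≤ M.rk (insert e K) := by
        refine rk_le_of_subset_closure (Set.insert_subset (M.mem_closure_of_mem (Or.inl rfl) hKE)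
          (Set.insert_subset hzK (Set.pair_subset (M.mem_closure_of_mem (Or.inr htK) hKE)
            (M.mem_closure_of_mem (Or.inr hy) hKE))))
      have h3 := M.rk_insert_le e K
      rw [hK.1.2] at h3
      have h4 := N.rk_submod (insert s T) {z, t, y}
      have h5 : N.rk {t, y} ≤ N.rk (insert s T ∩ {z, t, y}) := N.rk_mono
        (Set.pair_subset ⟨Or.inr ht, by simp⟩ ⟨Or.inr hyT, by simp⟩)
      rw [hNp (hTW ht) (hTW hyT) hyt.symm] at h5
      have h6 := N.rk_submod (W \ T) (insert s T ∪ {z, t, y})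
      have h7 : N.rk W ≤ N.rk (W \ T ∪ (insert s T ∪ {z, t, y})) := N.rk_mono fun u hu => by
        by_cases huT : u ∈ T
        · exact Or.inr (Or.inl (Or.inr huT))
        · exact Or.inl ⟨hu, huT⟩
      have h8 : N.rk {z, s} ≤ N.rk (W \ T ∩ (insert s T ∪ {z, t, y})) := N.rk_mono
        (Set.pair_subset ⟨⟨hz, hzT⟩, Or.inr (Or.inl rfl)⟩ ⟨⟨hsW, hsT⟩, Or.inl (Or.inl rfl)⟩)
      rw [hNp hz hsW hzs] at h8
      omega
    have hKE : insert e K ⊆ M.E := Set.insert_subset heE hK.1.subset_ground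
    by_cases hxL : x ∈ L
    · have hxe : x ≠ e := by
        rintro rfl
        have h1 : M.rk {x, t, y} ≤ M.rk K :=
          M.rk_mono (Set.insert_subset hx (Set.pair_subset htK hy))
        rw [hK.1.2] at h1
        exact hTL t ht (hlines t (hTE ht) y (hTE hyT) (fun h => hTL t ht (h ▸ heL))
          (fun h => hTL y hyT (h ▸ heL)) hyt.symm h1).1
      refine Or.inr ⟨hxL, key f (Or.inl rfl) hfT ?_⟩
      exact M.closure_subset_closure (Set.pair_subset (Or.inl rfl) (Or.inr hx))
        (hL.subset_closure_pair hM heL hxL hxe.symm hfL)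
    · exact Or.inl ⟨hxL, key x (Or.inr ⟨hK.1.subset_ground hx, hxL⟩) hxT
        (M.mem_closure_of_mem (Or.inr hx) hKE)⟩
  -- By `hlong`, the long lines through points of `T` stay inside `L ∪ T` if `s = f`, and inside
  -- `insert s T` otherwise. The existence results are applied to these restrictions, excluding the
  -- points of `L` or `s` respectively.
  obtain ⟨t, htT, ht⟩ : ∃ t ∈ T, M.OnAtMostOneLongLine t := by
    by_cases hsf : s = f
    · by_cases hl2 : 2 ≤ l
      · have hX : L ∪ T ⊆ M.E := Set.union_subset hL.subset_ground hTE
        have : (M ↾ (L ∪ T)).Finite := restrict_finite (M.ground_finite.subset hX)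
        have hL' : M.IsLongLine L := ⟨hL, by omega⟩
        by_contra! hcon
        obtain ⟨t, ht⟩ := hTn
        refine hTL t ht ((hL'.restrict hX Set.subset_union_left).ground_subset (hM.restrict hX)
          (h.noFigureMinor.isMinor (M.restrict_isMinor hX)) (fun x hx hx1 => ?_) (Or.inr ht))
        have hxT : x ∈ T := hx.1.resolve_left hx.2
        refine hcon x hxT (hx1.of_restrict hX fun K hK hxK z hz => ?_)
        by_cases hzT : z ∈ T
        · exact Or.inr hzT
        · rcases hlong K hK x hxT hxK z hz hzT with ⟨-, h2⟩ | ⟨h1, -⟩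
          · exact Or.inl (h2 ▸ hsf ▸ hfL)
          · exact Or.inl h1
      -- For `l = 1` every line has at most two points, so there are no long lines.
      · obtain ⟨t, ht⟩ := hTn
        refine ⟨t, ht, fun K K' hK => ?_⟩
        have h1 := hK.1.ncard_le hM h.noLineMinor
        have h2 := hK.2
        omega
    · have hX : insert s T ⊆ M.E := Set.insert_subset (hWE hsW) hTE
      have : (M ↾ insert s T).Finite := restrict_finite (M.ground_finite.subset hX)
      obtain ⟨u, hu⟩ := hTn
      obtain ⟨t, ht, hts, ht1⟩ := exists_ne_onAtMostOneLongLine (s := s) (hM.restrict hX)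
        (h.noFigureMinor.isMinor (M.restrict_isMinor hX))
        ⟨u, Or.inr hu, fun h => hsT (h ▸ hu)⟩
      have htT : t ∈ T := ht.resolve_left hts
      refine ⟨t, htT, ht1.of_restrict hX fun K hK htK z hz => ?_⟩
      by_cases hzT : z ∈ T
      · exact Or.inr hzT
      · rcases hlong K hK t htT htK z hz hzT with ⟨-, h2⟩ | ⟨-, h1⟩
        · exact Or.inl h2
        · exact absurd h1.symm hsf
  -- The bound for the contraction of `t` and equality for `M` force `K` to have `l + 1` points. At
  -- most one is outside `T`, and `T` has `l` points, so `K` is `T` with one more point.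
  obtain ⟨K, hK, htK, hKl, -, f', -, -, -, hN', hNr', hWc'⟩ := h.exists_isLine_minor ht (hTE htT) hr
  have hNc' := hN'.ncard_le hNr'
  rw [restrict_ground_eq] at hNc'
  have hKc : K.ncard = l + 1 := by omega
  have hKf : K.Finite := M.ground_finite.subset hK.subset_ground
  have hTf : T.Finite := M.ground_finite.subset hTE
  have hsplit := Set.ncard_inter_add_ncard_sdiff_eq_ncard K T hKf
  have h1 : (K \ T).ncard ≤ 1 := by
    rw [Set.ncard_le_one_iff hKf.sdiff]
    intro a b ha hb
    exact hKH K hK t htT htK a ha.1 b hb.1 ha.2 hb.2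
  have h2 : (K ∩ T).ncard ≤ T.ncard := Set.ncard_le_ncard Set.inter_subset_right hTf
  have hTK : T ⊆ K := by
    rw [← Set.inter_eq_right]
    exact Set.eq_of_subset_of_ncard_le Set.inter_subset_right (by omega) hTf
  obtain ⟨x, hx⟩ := Set.ncard_eq_one.1 (show (K \ T).ncard = 1 by omega)
  refine ⟨M.E \ T, K, x, hH, hK, ?_, ?_, hKc, hHr', ?_⟩
  · rw [← hx]
    ext z
    exact ⟨fun hz => ⟨hz.2, hz.1.2⟩, fun hz => ⟨⟨hK.subset_ground hz.1, hz.2⟩, hz.1⟩⟩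
  · refine Set.Subset.antisymm (fun z hz => ?_) (Set.union_subset Set.sdiff_subset hK.subset_ground)
    by_cases hzT : z ∈ T
    · exact Or.inr (hTK hzT)
    · exact Or.inl ⟨hz, hzT⟩
  · have h3 := Set.ncard_sdiff_add_ncard_of_subset hTE M.ground_finite
    omega

/-- The matroids attaining the bound are parallel connections of copies of `U_{2,l+1}`. -/
theorem IsBoundedSimple.isLineParallelConnection (hl : 1 ≤ l) (h : IsBoundedSimple l M)
    (hr : M.rk M.E = r + 1) (hcard : M.E.ncard = l * r + 1) : IsLineParallelConnection l M := by
  induction r generalizing M with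
  | zero =>
    obtain ⟨e, he⟩ := Set.ncard_eq_one.1 (by simpa using hcard)
    refine .point M e he ?_
    have heE : e ∈ M.E := he ▸ rfl
    have h1 := h.isSimple e heE e heE
    rwa [Set.pair_eq_singleton] at h1
  | succ r ih =>
    have hfin := h.finite
    rcases r with _ | m
    · exact .line M (isCopyOf_uniformTwo h.isSimple (by omega) (by omega))
    · obtain ⟨H, K, x, hH, hK, hHK, hE, hKc, hHr, hHc⟩ := h.exists_flat_line hl hr hcard
        fun N hN hNr hNc => ih hN hNr hNc
      have hKE := hK.subset_ground
      have : (M ↾ K).Finite := restrict_finite (M.ground_finite.subset hKE)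
      refine .connect M (M ↾ H) (M ↾ K) x (ih (h.restrict hH.subset_ground) ?_ hHc) ?_
        (isParallelConnection_restrict h.isSimple hH hK hHK hE)
      · rw [restrict_ground_eq, rk_restrict _ subset_rfl, hHr]
      · refine isCopyOf_uniformTwo (h.isSimple.restrict hKE) ?_ hKc
        rw [restrict_ground_eq, rk_restrict _ subset_rfl, hK.2]

end Extremal

end Matroid

theorem theorem5p1 {α : Type*} (r l : ℕ) (hr : 1 ≤ r) (hl : 1 ≤ l)
    (M : Matroid α) (hfin : M.Finite) (hrank : M.eRank = r) (hsimple : M.IsSimple)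
    (hfig : M.NoFigureMinor) (hline : ¬ M.HasMinor (Matroid.uniformTwo (l + 2))) :
    M.E.ncard ≤ l * (r - 1) + 1 ∧
      (M.E.ncard = l * (r - 1) + 1 ↔ Matroid.IsLineParallelConnection l M) := by
  obtain ⟨r, rfl⟩ : ∃ k, r = k + 1 := ⟨r - 1, by omega⟩
  rw [Nat.add_sub_cancel]
  have h : Matroid.IsBoundedSimple l M := ⟨hfin, hsimple, hfig, hline⟩
  have hrk : M.rk M.E = r + 1 := by
    rw [Matroid.eRank_eq_rk] at hrank
    exact_mod_cast hrank
  refine ⟨h.ncard_le hrk, h.isLineParallelConnection hl hrk, fun hM => ?_⟩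
  obtain ⟨-, -, k, hk, hcard⟩ := hM.properties hl
  rw [hcard, show k = r by omega]
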